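/- Let $R$ be a commutative Noetherian ring with nonzero identity. A finitely generated $R$-module $C$ is called semidualizing if the homothety map $R\to\mathrm{Hom}_R(C,C)$ is an isomorphism and $\mathrm{Ext}^i_R(C,C)=0$ for all $i>0$. A proper $\mathscr P_C$-projective resolution of an $R$-module $M$ is a complex $X=\cdots\to X_1\to X_0\to 0$ together with an augmentation $X_0\to M$ such that each $X_n$ is isomorphic to $C\otimes_R P_n$ with $P_n$ projective, $X^+=\cdots\to X_1\to X_0\to M\to 0$ is a complex, and $\mathrm{Hom}_R(C,X^+)$ is exact. A proper $\mathscr I_C$-injective resolution of an $R$-module $N$ is a complex $Y=0\to Y^0\to Y^1\to\cdots$ together with a map $N\to Y^0$ such that each $Y^n$ is isomorphic to $\mathrm{Hom}_R(C,I^n)$ with $I^n$ injective, $Y^+=0\to N\to Y^0\to Y^1\to\cdots$ is a complex, and $C\otimes_R Y^+$ is exact. Such resolutions always exist, and one sets $$\mathrm{Ext}^n_{\mathscr P_C}(M,N):=H^n(\mathrm{Hom}_R(X,N)),\qquad \mathrm{Ext}^n_{\mathscr I_C}(M,N):=H^n(\mathrm{Hom}_R(M,Y)),$$ where $X$ is a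 proper $\mathscr P_C$-projective resolution of $M$ and $Y$ is a proper $\mathscr I_C$-injective resolution of $N$. **Theorem 3.3.** Let $B$ and $C$ be two semidualizing $R$-modules. The following are equivalent: (i) $[B]\approx[C]$, that is, there is a finitely generated projective $R$-module $P$ of rank $1$ with $C\cong B\otimes_R P$. (ii) $\mathrm{Ext}^i_{\mathscr P_C}(M,N)\cong\mathrm{Ext}^i_{\mathscr P_B}(M,N)$ as $R$-modules for all $R$-modules $M$ and $N$ and all $i\ge 0$. (iii) $\mathrm{Ext}^i_{\mathscr I_C}(M,N)\cong\mathrm{Ext}^i_{\mathscr I_B}(M,N)$ as $R$-modules for all $R$-modules $M$ and $N$ and all $i\ge 0$. -/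

import Mathlib

universe u

open CategoryTheory Opposite TensorProduct

noncomputable section

/-- A semidualizing `R`-module: finitely generated, the homothety map `R → Hom_R(C, C)`,
`r ↦ (c ↦ r • c)`, is bijective, and `Ext^i_R(C, C) = 0` for all `i > 0`. -/
structure IsSemidualizing {R : Type u} [CommRing R] (C : ModuleCat.{u} R) : Prop where
  finite : Module.Finite R C
  homothety_bijective : Function.Bijective (LinearMap.lsmul R C : R →ₗ[R] (C →ₗ[R] C))
  ext_eq_zero : ∀ i : ℕ, 0 < i → Subsingleton (Abelian.Ext C C i)

/-- `[B] ≈ [C]`: there is a finitely generated projective `R`-module `P` of (constant) rank `1`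
with `C ≅ B ⊗ P`. -/
def PicEquivalent {R : Type u} [CommRing R] (B C : ModuleCat.{u} R) : Prop :=
  ∃ P : ModuleCat.{u} R, Module.Finite R P ∧ Module.Projective R P ∧
    (∀ p : PrimeSpectrum R, Module.rankAtStalk P p = 1) ∧ Nonempty (C ≃ₗ[R] (B ⊗[R] P))

/-- `X` is `C`-projective: `X ≅ C ⊗ P` with `P` projective. -/
def IsCProjective {R : Type u} [CommRing R] (C X : ModuleCat.{u} R) : Prop :=
  ∃ P : ModuleCat.{u} R, Module.Projective R P ∧ Nonempty (X ≃ₗ[R] (C ⊗[R] P))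

/-- `X` is `C`-injective: `X ≅ Hom_R(C, I)` with `I` injective. -/
def IsCInjective {R : Type u} [CommRing R] (C X : ModuleCat.{u} R) : Prop :=
  ∃ I : ModuleCat.{u} R, Module.Injective R I ∧ Nonempty (X ≃ₗ[R] (C →ₗ[R] I))

/-- A proper `P_C`-projective resolution of `M`: a complex `X` of `C`-projective modules with
an augmentation `X₀ ⟶ M` such that `Hom_R(C, -)` makes the augmented complex `X⁺` exact
(in all degrees, including those of `X₀` and `M`). -/
structure ProperPResolution {R : Type u} [CommRing R] (C M : ModuleCat.{u} R) where
  complex : ChainComplex (ModuleCat.{u} R) ℕ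
  isCProjective : ∀ n : ℕ, IsCProjective C (complex.X n)
  π : complex.X 0 ⟶ M
  d_comp_π : complex.d 1 0 ≫ π = 0
  exact : ((((linearCoyoneda R (ModuleCat.{u} R)).obj (op C)).mapHomologicalComplex
    (ComplexShape.down ℕ)).obj (complex.augment π d_comp_π)).Acyclic

/-- A proper `I_C`-injective resolution of `N`: a cocomplex `Y` of `C`-injective modules with
a coaugmentation `N ⟶ Y⁰` such that `C ⊗ -` makes the augmented complex `Y⁺` exact
(in all degrees, including those of `N` and `Y⁰`). -/
structure ProperIResolution {R : Type u} [CommRing R] (C N : ModuleCat.{u} R) where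
  cocomplex : CochainComplex (ModuleCat.{u} R) ℕ
  isCInjective : ∀ n : ℕ, IsCInjective C (cocomplex.X n)
  ι : N ⟶ cocomplex.X 0
  ι_comp_d : ι ≫ cocomplex.d 0 1 = 0
  exact : (((MonoidalCategory.tensorLeft C).mapHomologicalComplex
    (ComplexShape.up ℕ)).obj (cocomplex.augment ι ι_comp_d)).Acyclic

/-! ### Existence of proper `P_C`-projective resolutions -/

namespace ProperPResolution

variable {R : Type u} [CommRing R] (C M : ModuleCat.{u} R)

/-- The direct sum of copies of `C` indexed by `Hom_R(C, K)`. -/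
def cover (K : ModuleCat.{u} R) : ModuleCat.{u} R := ModuleCat.of R ((C →ₗ[R] K) →₀ C)

/-- The evaluation map from the direct sum of copies of `C` to `K`. -/
def coverMap (K : ModuleCat.{u} R) : cover C K ⟶ K :=
  ModuleCat.ofHom (Finsupp.lsum R (fun f : C →ₗ[R] K => f))

theorem coverMap_lift (K : ModuleCat.{u} R) (g : C ⟶ K) :
    ∃ g' : C ⟶ cover C K, g' ≫ coverMap C K = g := by
  refine ⟨ModuleCat.ofHom (Finsupp.lsingle g.hom), ?_⟩
  ext c
  change Finsupp.lsum R (fun f : C →ₗ[R] K => f) (Finsupp.single g.hom c) = g.hom c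
  simp

theorem isCProjective_cover (K : ModuleCat.{u} R) : IsCProjective C (cover C K) := by
  classical
  exact ⟨ModuleCat.of R ((C →ₗ[R] K) →₀ R), inferInstanceAs (Module.Projective R (_ →₀ R)),
    ⟨(TensorProduct.finsuppScalarRight R R C (C →ₗ[R] K)).symm⟩⟩

/-- The iterated kernels of the evaluation maps. -/
def syz : ℕ → ModuleCat.{u} R
  | 0 => M
  | n + 1 => ModuleCat.of R (LinearMap.ker (coverMap C (syz n)).hom)

/-- The inclusion of the kernel of the evaluation map. -/
def syzIncl (n : ℕ) : syz C M (n + 1) ⟶ cover C (syz C M n) :=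
  ModuleCat.ofHom (LinearMap.ker (coverMap C (syz C M n)).hom).subtype

theorem syzIncl_comp (n : ℕ) : syzIncl C M n ≫ coverMap C (syz C M n) = 0 := by
  ext x
  exact x.2

theorem syzIncl_lift (n : ℕ) (g : C ⟶ cover C (syz C M n))
    (hg : g ≫ coverMap C (syz C M n) = 0) : ∃ g' : C ⟶ syz C M (n + 1), g' ≫ syzIncl C M n = g :=
  ⟨ModuleCat.ofHom (LinearMap.codRestrict _ g.hom
    (fun c => LinearMap.congr_fun (congrArg ModuleCat.Hom.hom hg) c)), by ext c; rfl⟩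

theorem syzIncl_cancel (n : ℕ) (g : C ⟶ syz C M (n + 1)) (hg : g ≫ syzIncl C M n = 0) : g = 0 := by
  ext c
  exact Subtype.ext (congrArg (fun h => h.hom c) hg)

/-- The complex obtained by splicing the evaluation maps. -/
def stdComplex : ChainComplex (ModuleCat.{u} R) ℕ :=
  ChainComplex.of (fun n => cover C (syz C M n))
    (fun n => coverMap C (syz C M (n + 1)) ≫ syzIncl C M n)
    (fun n => by
      rw [Category.assoc, ← Category.assoc (syzIncl C M (n + 1)), syzIncl_comp]
      simp)

theorem stdComplex_d (n : ℕ) : (stdComplex C M).d (n + 1) n =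
    coverMap C (syz C M (n + 1)) ≫ syzIncl C M n :=
  ChainComplex.of_d (fun n => cover C (syz C M n))
    (fun n => coverMap C (syz C M (n + 1)) ≫ syzIncl C M n) n

theorem exactAt_of_lift (K : ChainComplex (ModuleCat.{u} R) ℕ) (i j k : ℕ)
    (hi : (ComplexShape.down ℕ).prev j = i) (hk : (ComplexShape.down ℕ).next j = k)
    (h : ∀ g : C ⟶ K.X j, g ≫ K.d j k = 0 → ∃ g' : C ⟶ K.X i, g' ≫ K.d i j = g) :
    ((((linearCoyoneda R (ModuleCat.{u} R)).obj (op C)).mapHomologicalComplex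
      (ComplexShape.down ℕ)).obj K).ExactAt j := by
  rw [HomologicalComplex.exactAt_iff' _ i j k hi hk, ShortComplex.moduleCat_exact_iff]
  exact h

theorem splice_lift (n : ℕ) (g : C ⟶ cover C (syz C M n))
    (hg : g ≫ coverMap C (syz C M n) = 0) :
    ∃ g' : C ⟶ cover C (syz C M (n + 1)),
      g' ≫ coverMap C (syz C M (n + 1)) ≫ syzIncl C M n = g := by
  obtain ⟨g₁, h₁⟩ := syzIncl_lift C M n g hg
  obtain ⟨g₂, h₂⟩ := coverMap_lift C _ g₁
  exact ⟨g₂, by rw [← Category.assoc, h₂, h₁]⟩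

/-- Every module admits a proper `P_C`-projective resolution. -/
theorem nonempty : Nonempty (ProperPResolution C M) := by
  have w : (stdComplex C M).d 1 0 ≫ (coverMap C M : (stdComplex C M).X 0 ⟶ M) = 0 := by
    have h : (coverMap C (syz C M 1) ≫ syzIncl C M 0) ≫ coverMap C (syz C M 0) = 0 := by
      rw [Category.assoc, syzIncl_comp]
      exact Limits.comp_zero
    exact (congrArg (fun f => f ≫ (coverMap C M : (stdComplex C M).X 0 ⟶ M))
      (stdComplex_d C M 0)).trans h
  refine ⟨stdComplex C M, fun n => isCProjective_cover C _, coverMap C M, w, ?_⟩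
  rintro (_ | _ | n)
  · refine exactAt_of_lift C _ 1 0 0 (by simp) (by simp) fun g _ => ?_
    exact coverMap_lift C M g
  · refine exactAt_of_lift C _ 2 1 0 (by simp) (by simp) fun g hg => ?_
    obtain ⟨g', h⟩ := splice_lift C M 0 g hg
    exact ⟨g', (congrArg (fun f => (g' ≫ f : C ⟶ (stdComplex C M).X 0))
      (stdComplex_d C M 0)).trans h⟩
  · refine exactAt_of_lift C _ (n + 3) (n + 2) (n + 1) (by simp) (by simp) fun g hg => ?_
    have hg' : g ≫ coverMap C (syz C M (n + 1)) ≫ syzIncl C M n = 0 :=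
      (congrArg (fun f => ((show C ⟶ (stdComplex C M).X (n + 1) from g) ≫ f :
        C ⟶ (stdComplex C M).X n)) (stdComplex_d C M n)).symm.trans hg
    obtain ⟨g', h⟩ := splice_lift C M (n + 1) g
      (syzIncl_cancel C M n _ ((Category.assoc _ _ _).trans hg'))
    exact ⟨g', (congrArg (fun f => (g' ≫ f : C ⟶ (stdComplex C M).X (n + 1)))
      (stdComplex_d C M (n + 1))).trans h⟩

end ProperPResolution

/-! ### Existence of proper `I_C`-injective resolutions -/

namespace ProperIResolution

variable {R : Type u} [CommRing R] (C N : ModuleCat.{u} R)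

/-- An injective module containing `C ⊗ L`. -/
def inj (L : ModuleCat.{u} R) : ModuleCat.{u} R :=
  Injective.under (ModuleCat.of R (C ⊗[R] L))

/-- `Hom_R(C, I)` for an injective module `I` containing `C ⊗ L`. -/
def hull (L : ModuleCat.{u} R) : ModuleCat.{u} R := ModuleCat.of R (C →ₗ[R] inj C L)

/-- The map `L → Hom_R(C, I)` adjoint to the embedding `C ⊗ L → I`. -/
def hullMap (L : ModuleCat.{u} R) : L →ₗ[R] hull C L :=
  (TensorProduct.curry (Injective.ι (ModuleCat.of R (C ⊗[R] L))).hom).flip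

theorem lTensor_hullMap_injective (L : ModuleCat.{u} R) :
    Function.Injective ((hullMap C L).lTensor C) := by
  have h : (TensorProduct.lift (LinearMap.id (R := R) (M := C →ₗ[R] inj C L)).flip) ∘ₗ
      ((hullMap C L).lTensor C) = (Injective.ι (ModuleCat.of R (C ⊗[R] L))).hom := by
    apply TensorProduct.ext'
    intro c l
    rfl
  have hinj : Function.Injective (Injective.ι (ModuleCat.of R (C ⊗[R] L))).hom :=
    (ModuleCat.mono_iff_injective _).1 inferInstance
  rw [← h] at hinj
  exact Function.Injective.of_comp (f := TensorProduct.lift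
    (LinearMap.id (R := R) (M := C →ₗ[R] inj C L)).flip) hinj

theorem isCInjective_hull (L : ModuleCat.{u} R) : IsCInjective C (hull C L) :=
  ⟨inj C L, (Module.injective_iff_injective_object R _).2
    (inferInstanceAs (Injective (Injective.under _))), ⟨LinearEquiv.refl R _⟩⟩

/-- The iterated cokernels of the maps `L → Hom_R(C, I)`. -/
def cosyz : ℕ → ModuleCat.{u} R
  | 0 => N
  | n + 1 => ModuleCat.of R (hull C (cosyz n) ⧸ LinearMap.range (hullMap C (cosyz n)))

/-- The projection onto the cokernel. -/
def cosyzProj (n : ℕ) : hull C (cosyz C N n) →ₗ[R] cosyz C N (n + 1) :=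
  (LinearMap.range (hullMap C (cosyz C N n))).mkQ

theorem cosyzProj_surjective (n : ℕ) : Function.Surjective (cosyzProj C N n) :=
  Submodule.mkQ_surjective _

theorem cosyzProj_exact (n : ℕ) :
    Function.Exact (hullMap C (cosyz C N n)) (cosyzProj C N n) :=
  LinearMap.exact_map_mkQ_range _

/-- The cocomplex obtained by splicing. -/
def stdCocomplex : CochainComplex (ModuleCat.{u} R) ℕ :=
  CochainComplex.of (fun n => hull C (cosyz C N n))
    (fun n => ModuleCat.ofHom (hullMap C (cosyz C N (n + 1)) ∘ₗ cosyzProj C N n))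
    (fun n => by
      ext x
      change hullMap C _ (cosyzProj C N (n + 1) (hullMap C _ (cosyzProj C N n x))) = 0
      rw [(cosyzProj_exact C N (n + 1)).apply_apply_eq_zero, map_zero])

theorem stdCocomplex_d (n : ℕ) : (stdCocomplex C N).d n (n + 1) =
    ModuleCat.ofHom (hullMap C (cosyz C N (n + 1)) ∘ₗ cosyzProj C N n) :=
  CochainComplex.of_d (fun n => hull C (cosyz C N n))
    (fun n => ModuleCat.ofHom (hullMap C (cosyz C N (n + 1)) ∘ₗ cosyzProj C N n)) n

theorem exactAt_of_exact (K : CochainComplex (ModuleCat.{u} R) ℕ) (i j k : ℕ)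
    (hi : (ComplexShape.up ℕ).prev j = i) (hk : (ComplexShape.up ℕ).next j = k)
    (h : ∀ x : (C ⊗[R] K.X j), (K.d j k).hom.lTensor C x = 0 →
      ∃ y : (C ⊗[R] K.X i), (K.d i j).hom.lTensor C y = x) :
    (((MonoidalCategory.tensorLeft C).mapHomologicalComplex
      (ComplexShape.up ℕ)).obj K).ExactAt j := by
  rw [HomologicalComplex.exactAt_iff' _ i j k hi hk, ShortComplex.moduleCat_exact_iff]
  exact h

theorem stdCocomplex_d_lTensor (n : ℕ) (x : C ⊗[R] hull C (cosyz C N n)) :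
    ((stdCocomplex C N).d n (n + 1)).hom.lTensor C x =
      (hullMap C (cosyz C N (n + 1))).lTensor C ((cosyzProj C N n).lTensor C x) := by
  rw [stdCocomplex_d]
  exact LinearMap.congr_fun (LinearMap.lTensor_comp C _ _) x

theorem splice_exact (n : ℕ) (x : C ⊗[R] hull C (cosyz C N n))
    (hx : ((stdCocomplex C N).d n (n + 1)).hom.lTensor C x = 0) :
    ∃ y : C ⊗[R] cosyz C N n, (hullMap C (cosyz C N n)).lTensor C y = x := by
  have h := (stdCocomplex_d_lTensor C N n x).symm.trans hx
  have h' : (cosyzProj C N n).lTensor C x = 0 :=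
    lTensor_hullMap_injective C _ (h.trans (map_zero _).symm)
  exact (lTensor_exact C (cosyzProj_exact C N n) (cosyzProj_surjective C N n) x).1 h'

/-- Every module admits a proper `I_C`-injective resolution. -/
theorem nonempty : Nonempty (ProperIResolution C N) := by
  have w : (ModuleCat.ofHom (hullMap C N) : N ⟶ (stdCocomplex C N).X 0) ≫
      (stdCocomplex C N).d 0 1 = 0 := by
    rw [stdCocomplex_d]
    ext x
    change hullMap C _ (cosyzProj C N 0 (hullMap C (cosyz C N 0) x)) = 0
    exact (congrArg (hullMap C (cosyz C N 1))
      ((cosyzProj_exact C N 0).apply_apply_eq_zero x)).trans (map_zero _)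
  refine ⟨stdCocomplex C N, fun n => isCInjective_hull C _, ModuleCat.ofHom (hullMap C N), w, ?_⟩
  rintro (_ | _ | n)
  · refine exactAt_of_exact C _ 0 0 1 (by simp) (by simp) fun x hx => ⟨0, ?_⟩
    rw [map_zero]
    exact (lTensor_hullMap_injective C N (hx.trans (map_zero _).symm)).symm
  · refine exactAt_of_exact C _ 0 1 2 (by simp) (by simp) fun x hx => ?_
    exact splice_exact C N 0 x hx
  · refine exactAt_of_exact C _ (n + 1) (n + 2) (n + 3) (by simp) (by simp) fun x hx => ?_
    obtain ⟨y, hy⟩ := splice_exact C N (n + 1) x hx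
    obtain ⟨z, hz⟩ := LinearMap.lTensor_surjective C (cosyzProj_surjective C N n) y
    refine ⟨z, (stdCocomplex_d_lTensor C N n z).trans ?_⟩
    rw [hz]
    exact hy

end ProperIResolution

/-- The relative Ext module `Ext^n_{P_C}(M, N)`: the `n`-th cohomology of `Hom_R(L, N)`, where
`L` is a (chosen) proper `P_C`-projective resolution of `M`. -/
def relExtP {R : Type u} [CommRing R] (C M N : ModuleCat.{u} R) (n : ℕ) : ModuleCat.{u} R :=
  ((ProperPResolution.nonempty C M).some.complex.linearYonedaObj R N).homology n

/-- The relative Ext module `Ext^n_{I_C}(M, N)`: the `n`-th cohomology of `Hom_R(M, J)`, where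
`J` is a (chosen) proper `I_C`-injective resolution of `N`. -/
def relExtI {R : Type u} [CommRing R] (C M N : ModuleCat.{u} R) (n : ℕ) : ModuleCat.{u} R :=
  ((((linearCoyoneda R (ModuleCat.{u} R)).obj (op M)).mapHomologicalComplex
    (ComplexShape.up ℕ)).obj (ProperIResolution.nonempty C N).some.cocomplex).homology n

end

/-! The relative Ext modules are ordinary Ext modules in disguise. If `X` is a proper P_C-projective
resolution of `M`, the unit isomorphism P ≅ Hom(C, C ⊗ P) makes Hom(C, X) a projective resolution of
Hom(C, M), and Hom(X, N) ≅ Hom(Hom(C, X), Hom(C, N)); so Ext_{P_C}(M, N) ≅ Ext(Hom(C, M), Hom(C,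
N)). Dually, C ⊗ Hom(C, I) ≅ I for `I` injective, whence Ext_{I_C}(M, N) ≅ Ext(C ⊗ M, C ⊗ N). In
particular any proper resolution may be used.

If C ≅ B ⊗ P with `P` of rank one, then C-projectives are B-projective and C-injectives are
B-injective, by associativity and adjunction. The trace ideal of `P` is `R`, so `B` is a summand of
a finite power of `C`, and properness passes from `C` to `B`. A proper resolution for `C` is thus
one for `B`, which gives (ii) and (iii).

Conversely, put T = Hom(B, C). Under (ii), Ext^1_{P_C}(C, -) = 0 gives Ext^1(T, Hom(B, R/m)) = 0 for
every maximal ideal `m`. Since R/m is a retract of Hom(B, R/m), maps to R/m extend from the kernel K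
of a free cover F → T; hence K/mK → F/mF is injective and T is projective. Under (iii) the same
extension property, with values in an injective E ⊇ R/m, comes from Ext^1(B ⊗ R/m, B ⊗ Hom(C, E)) =
0 and B ⊗ Hom(C, E) ≅ Hom(T, E). By symmetry T' = Hom(C, B) is projective too. The evaluations B ⊗ T
→ C and C ⊗ T' → B are then isomorphisms, so B ≅ B ⊗ (T ⊗ T'); applying Hom(B, -) yields T ⊗ T' ≅ R,
and T has rank one. -/

noncomputable section

/-! ### Unit and evaluation isomorphisms for Hom and tensor -/

section UnitEval

variable {R : Type*} [CommRing R]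

/-- If `R → End C` is bijective and `C` is finite, then `P → Hom(C, C ⊗ P)` is bijective for every
projective module `P`. -/
theorem TensorProduct.mk_flip_bijective_of_projective {C P : Type*} [AddCommGroup C] [Module R C]
    [AddCommGroup P] [Module R P] [Module.Finite R C] [Module.Projective R P]
    (hC : Function.Bijective (LinearMap.lsmul R C : R →ₗ[R] (C →ₗ[R] C))) :
    Function.Bijective ((TensorProduct.mk R C P).flip) := by
  classical
  obtain ⟨s, hs⟩ := Module.projective_def'.1 ‹Module.Projective R P›
  have key : ∀ (c : C) (q : P →₀ R) (i : P),
      TensorProduct.finsuppScalarRight R R C P (c ⊗ₜ q) i = q i • c := fun c q i =>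
    TensorProduct.finsuppScalarRight_apply_tmul_apply c q i
  constructor
  · rw [← LinearMap.ker_eq_bot, LinearMap.ker_eq_bot']
    intro p hp
    -- Every coordinate of `s p` annihilates `C`, hence vanishes.
    have h0 : s p = 0 := by
      ext i
      apply hC.1
      ext c
      have h1 : c ⊗ₜ[R] p = 0 := LinearMap.congr_fun hp c
      have h2 := congrArg (fun x => TensorProduct.finsuppScalarRight R R C P (s.lTensor C x) i) h1
      simpa [key] using h2
    have h3 := LinearMap.congr_fun hs p
    simpa [h0] using h3.symm
  · intro f
    -- After embedding in a free module, each coordinate of `f` is an endomorphism of `C`, that is,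
    -- a scalar. Since `C` is finitely generated, only finitely many of these scalars are nonzero,
    -- so they form an element of the free module.
    have h1 : ∀ i : P, ∃ r : R, LinearMap.lsmul R C r =
        Finsupp.lapply i ∘ₗ (TensorProduct.finsuppScalarRight R R C P).toLinearMap ∘ₗ
          s.lTensor C ∘ₗ f := fun i => hC.2 _
    choose r hr using h1
    have hr' : ∀ i c, r i • c = TensorProduct.finsuppScalarRight R R C P (s.lTensor C (f c)) i :=
      fun i c => LinearMap.congr_fun (hr i) c
    obtain ⟨S, hS⟩ := ‹Module.Finite R C›.fg_top
    let t : Finset P := S.biUnion fun c =>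
      (TensorProduct.finsuppScalarRight R R C P (s.lTensor C (f c))).support
    have ht : ∀ i, r i ≠ 0 → i ∈ t := by
      intro i hi
      by_contra hit
      apply hi
      apply hC.1
      rw [map_zero]
      refine LinearMap.ext_on hS fun c hc => ?_
      have : i ∉ (TensorProduct.finsuppScalarRight R R C P (s.lTensor C (f c))).support :=
        fun h => hit (Finset.mem_biUnion.2 ⟨c, hc, h⟩)
      simpa [hr' i c] using this
    let q : P →₀ R := Finsupp.onFinset t r ht
    refine ⟨Finsupp.linearCombination R id q, ?_⟩
    ext c
    have h2 : c ⊗ₜ[R] q = s.lTensor C (f c) := by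
      apply (TensorProduct.finsuppScalarRight R R C P).injective
      ext i
      rw [key, ← hr']
      rfl
    have h3 := congrArg ((Finsupp.linearCombination R (id : P → P)).lTensor C) h2
    rw [← LinearMap.comp_apply ((Finsupp.linearCombination R (id : P → P)).lTensor C),
      ← LinearMap.lTensor_comp, hs, LinearMap.lTensor_id] at h3
    simpa using h3

/-- A linear map vanishing on the kernel of a surjection factors through it. -/
theorem LinearMap.exists_comp_eq_of_ker_le {M N P : Type*} [AddCommGroup M] [Module R M]
    [AddCommGroup N] [Module R N] [AddCommGroup P] [Module R P] {p : M →ₗ[R] N}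
    (hp : Function.Surjective p) {f : M →ₗ[R] P} (h : LinearMap.ker p ≤ LinearMap.ker f) :
    ∃ f' : N →ₗ[R] P, f' ∘ₗ p = f := by
  refine ⟨(LinearMap.ker p).liftQ f h ∘ₗ (p.quotKerEquivOfSurjective hp).symm.toLinearMap,
    LinearMap.ext fun x => ?_⟩
  have : (p.quotKerEquivOfSurjective hp).symm (p x) = (LinearMap.ker p).mkQ x := by
    rw [LinearEquiv.symm_apply_eq]; rfl
  simp [this]

/-- The evaluation map `X ⊗ Hom(C, I) → Hom(Hom(X, C), I)`. -/
def tensorHomEval (R X C I : Type*) [CommRing R] [AddCommGroup X] [Module R X] [AddCommGroup C]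
    [Module R C] [AddCommGroup I] [Module R I] :
    X ⊗[R] (C →ₗ[R] I) →ₗ[R] ((X →ₗ[R] C) →ₗ[R] I) :=
  TensorProduct.lift ((LinearMap.llcomp R (X →ₗ[R] C) C I).flip ∘ₗ LinearMap.applyₗ)

@[simp]
theorem tensorHomEval_tmul {X C I : Type*} [AddCommGroup X] [Module R X] [AddCommGroup C]
    [Module R C] [AddCommGroup I] [Module R I] (x : X) (φ : C →ₗ[R] I) (g : X →ₗ[R] C) :
    tensorHomEval R X C I (x ⊗ₜ φ) g = φ (g x) := rfl

theorem tensorHomEval_rTensor {X X' C I : Type*} [AddCommGroup X] [Module R X] [AddCommGroup X']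
    [Module R X'] [AddCommGroup C] [Module R C] [AddCommGroup I] [Module R I] (f : X →ₗ[R] X')
    (y : X ⊗[R] (C →ₗ[R] I)) :
    tensorHomEval R X' C I (f.rTensor _ y) = tensorHomEval R X C I y ∘ₗ f.lcomp R C := by
  induction y with
  | zero => simp
  | tmul x φ => ext g; simp
  | add y z hy hz => rw [map_add, map_add, hy, hz, map_add, LinearMap.add_comp]

theorem tensorHomEval_bijective_of_pi {ι C I : Type*} [Finite ι]
    [AddCommGroup C] [Module R C] [AddCommGroup I] [Module R I] :
    Function.Bijective (tensorHomEval R (ι → R) C I) := by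
  classical
  have := Fintype.ofFinite ι
  let inv : (((ι → R) →ₗ[R] C) →ₗ[R] I) → (ι → R) ⊗[R] (C →ₗ[R] I) := fun Ψ =>
    ∑ i, Pi.single i 1 ⊗ₜ (Ψ ∘ₗ LinearMap.smulRightₗ (LinearMap.proj i))
  refine Function.bijective_iff_has_inverse.2 ⟨inv, fun y => ?_, fun Ψ => ?_⟩
  · have hadd : ∀ a b, inv (a + b) = inv a + inv b := fun a b => by
      simp only [inv, ← Finset.sum_add_distrib, ← TensorProduct.tmul_add]
      rfl
    induction y with
    | zero => simp [inv]
    | tmul x φ =>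
      have h : ∀ i, (tensorHomEval R (ι → R) C I (x ⊗ₜ φ)) ∘ₗ
          LinearMap.smulRightₗ (LinearMap.proj i) = x i • φ := fun i => by
        ext c; simp
      simp only [inv, h, TensorProduct.tmul_smul, TensorProduct.smul_tmul', ← TensorProduct.sum_tmul]
      congr 1
      ext j
      simp [Finset.sum_apply, Pi.single_apply]
    | add y z hy hz => rw [map_add, hadd, hy, hz]
  · ext g
    simp only [inv, map_sum, LinearMap.sum_apply, tensorHomEval_tmul, LinearMap.comp_apply]
    rw [← map_sum]
    congr 1
    ext j
    simp [Pi.single_apply]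

/-- Diagram chase along a presentation R^m → R^n → X → 0, the free case being explicit. Injectivity
of `I` extends functionals from a submodule of Hom(R^n, C) or Hom(R^m, C). -/
theorem tensorHomEval_bijective {R X C I : Type u} [CommRing R] [IsNoetherianRing R]
    [AddCommGroup X] [Module R X] [Module.Finite R X] [AddCommGroup C] [Module R C]
    [AddCommGroup I] [Module R I] [Module.Injective R I] :
    Function.Bijective (tensorHomEval R X C I) := by
  obtain ⟨n, f, hf⟩ := Module.Finite.exists_fin' R X
  obtain ⟨m, g₀, hg₀⟩ := Module.Finite.exists_fin' R (LinearMap.ker f)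
  let g := (LinearMap.ker f).subtype ∘ₗ g₀
  have hfg : f ∘ₗ g = 0 := by ext x; exact (g₀ _).2
  have hg : ∀ x, f x = 0 → ∃ y, g y = x := fun x hx => by
    obtain ⟨y, hy⟩ := hg₀ ⟨x, hx⟩
    exact ⟨y, congrArg Subtype.val hy⟩
  constructor
  · rw [← LinearMap.ker_eq_bot, LinearMap.ker_eq_bot']
    intro x hx
    obtain ⟨y, rfl⟩ := LinearMap.rTensor_surjective (C →ₗ[R] I) hf x
    rw [tensorHomEval_rTensor] at hx
    -- A map R^n → C killed by `g` factors through `X`, where the functional of `y` vanishes; so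
    -- this functional descends to the image of Hom(R^n, C) in Hom(R^m, C) and then extends to all
    -- of Hom(R^m, C).
    have hker : LinearMap.ker (LinearMap.lcomp R C g) ≤
        LinearMap.ker (tensorHomEval R (Fin n → R) C I y) := by
      intro φ hφ
      have hφ' : φ ∘ₗ g = 0 := hφ
      have hle : LinearMap.ker f ≤ LinearMap.ker φ := by
        intro v hv
        obtain ⟨w, rfl⟩ := hg v hv
        exact LinearMap.congr_fun hφ' w
      obtain ⟨ψ, hψ⟩ := LinearMap.exists_comp_eq_of_ker_le hf hle
      have := LinearMap.congr_fun hx ψ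
      rw [← hψ]
      exact this
    obtain ⟨z, hz⟩ := Module.Injective.out ((LinearMap.ker (LinearMap.lcomp R C g)).liftQ _ le_rfl)
      (LinearMap.ker_eq_bot.1 (Submodule.ker_liftQ_eq_bot _ _ _ le_rfl))
      ((LinearMap.ker (LinearMap.lcomp R C g)).liftQ _ hker)
    obtain ⟨w, hw⟩ := (tensorHomEval_bijective_of_pi (R := R) (ι := Fin m) (C := C) (I := I)).2 z
    have hyw : y = g.rTensor _ w := by
      apply (tensorHomEval_bijective_of_pi (R := R) (ι := Fin n) (C := C) (I := I)).1
      rw [tensorHomEval_rTensor, hw]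
      ext φ
      exact (hz (Submodule.Quotient.mk φ)).symm
    rw [hyw, ← LinearMap.comp_apply, ← LinearMap.rTensor_comp, hfg]
    simp
  · intro Ψ
    have hinj : Function.Injective (f.lcomp R C) := fun a b hab =>
      LinearMap.ext fun x => by obtain ⟨v, rfl⟩ := hf x; exact LinearMap.congr_fun hab v
    obtain ⟨z, hz⟩ := Module.Injective.out (f.lcomp R C) hinj Ψ
    obtain ⟨w, hw⟩ := (tensorHomEval_bijective_of_pi (R := R) (ι := Fin n) (C := C) (I := I)).2 z
    refine ⟨f.rTensor _ w, ?_⟩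
    rw [tensorHomEval_rTensor, hw]
    ext φ
    exact hz φ

end UnitEval

/-! ### A fibrewise criterion for projectivity -/

section LocalCriterion

variable {R : Type u} [CommRing R]

/-- Injectivity of `R/m ⊗ K → R/m ⊗ F` can be tested on functionals of `R/m ⊗ K`, up to enlarging
the target. -/
theorem lTensor_quotient_injective_of_extends (m : Ideal R) [m.IsMaximal] {K F : Type u}
    [AddCommGroup K] [Module R K] [AddCommGroup F] [Module R F] (i : K →ₗ[R] F)
    (H : ∀ h : K →ₗ[R] (R ⧸ m), ∃ (E : ModuleCat.{u} R) (j : (R ⧸ m) →ₗ[R] E)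
      (U : (R ⧸ m) →ₗ[R] (F →ₗ[R] E)), Function.Injective j ∧ ∀ k, U 1 (i k) = j (h k)) :
    Function.Injective (i.lTensor (R ⧸ m)) := by
  let : Field (R ⧸ m) := Ideal.Quotient.field m
  rw [← LinearMap.ker_eq_bot, LinearMap.ker_eq_bot']
  intro x hx
  by_contra hne
  obtain ⟨φ, hφ⟩ : ∃ φ : Module.Dual (R ⧸ m) ((R ⧸ m) ⊗[R] K), φ x ≠ 0 := by
    by_contra! h
    exact hne ((Module.forall_dual_apply_eq_zero_iff (R ⧸ m) x).1 h)
  obtain ⟨E, j, U, hj, hU⟩ := H (φ.restrictScalars R ∘ₗ TensorProduct.mk R (R ⧸ m) K 1)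
  -- `U` induces a map R/m ⊗ F → E extending `j ∘ φ`, so a kernel element of R/m ⊗ K → R/m ⊗ F is
  -- killed by `φ`.
  have key : TensorProduct.lift U ∘ₗ i.lTensor (R ⧸ m) = j ∘ₗ φ.restrictScalars R := by
    apply TensorProduct.ext'
    intro c k
    obtain ⟨r, rfl⟩ := Ideal.Quotient.mk_surjective c
    have hr : (Ideal.Quotient.mk m r) = r • (1 : R ⧸ m) := by
      rw [Algebra.smul_def, mul_one]; rfl
    have := hU k
    simp only [LinearMap.comp_apply, LinearMap.restrictScalars_apply, TensorProduct.mk_apply] at this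
    rw [hr, ← TensorProduct.smul_tmul', map_smul, map_smul]
    congr 1
  have h0 := LinearMap.congr_fun key x
  rw [LinearMap.comp_apply, hx, map_zero] at h0
  exact hφ (hj (h0.symm.trans (map_zero j).symm))

/-- A finite module `T` over a Noetherian ring with presentation `K → F → T` such that
`R/m ⊗ K → R/m ⊗ F` is injective for all maximal ideals `m` is projective. -/
theorem Module.projective_of_lTensor_quotient_injective [IsNoetherianRing R] {K F T : Type u}
    [AddCommGroup K] [Module R K] [AddCommGroup F] [Module R F] [AddCommGroup T] [Module R T]
    [Module.Finite R K] [Module.Finite R F] [Module.Free R F]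
    (i : K →ₗ[R] F) (p : F →ₗ[R] T) (hp : Function.Surjective p) (hip : Function.Exact i p)
    (H : ∀ (m : Ideal R) [m.IsMaximal], Function.Injective (i.lTensor (R ⧸ m))) :
    Module.Projective R T := by
  have : Module.Finite R T := Module.Finite.of_surjective p hp
  have : Module.FinitePresentation R T := Module.finitePresentation_of_finite R T
  refine Module.projective_of_localization_maximal fun m hm => ?_
  let Rm := Localization.AtPrime m
  let k := IsLocalRing.ResidueField Rm
  have hfree : Module.Free Rm (Rm ⊗[R] T) := by
    refine Module.free_of_lTensor_residueField_injective (i.baseChange Rm) (p.baseChange Rm)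
      (LinearMap.lTensor_surjective _ hp) (lTensor_exact Rm hip hp) ?_
    -- R/m is already the residue field of the localization, and base change in stages identifies k
    -- ⊗ (Rm ⊗ K) over `Rm` with k ⊗ K over `R`.
    have h1 : Function.Injective (i.lTensor k) := by
      let e : (R ⧸ m) ≃ₗ[R] k := LinearEquiv.ofBijective
        (IsScalarTower.toAlgHom R (R ⧸ m) m.ResidueField).toLinearMap
        m.bijective_algebraMap_quotient_residueField
      have h : i.lTensor k = (e.toLinearMap.rTensor F ∘ₗ i.lTensor (R ⧸ m)) ∘ₗ
          e.symm.toLinearMap.rTensor K := by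
        apply TensorProduct.ext'
        intro a b
        simp
      rw [h]
      exact ((LinearEquiv.rTensor F e).injective.comp (H m)).comp
        (LinearEquiv.rTensor K e.symm).injective
    have h2 : ∀ x, TensorProduct.AlgebraTensorModule.cancelBaseChange R Rm Rm k F
        ((i.baseChange Rm).lTensor k x) =
        i.lTensor k (TensorProduct.AlgebraTensorModule.cancelBaseChange R Rm Rm k K x) := by
      intro x
      induction x with
      | zero => simp
      | add y z hy hz => simp only [map_add, hy, hz]
      | tmul a y =>
        induction y with
        | zero => simp
        | add y z hy hz => simp only [TensorProduct.tmul_add, map_add, hy, hz]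
        | tmul b z => simp
    intro x y hxy
    apply (TensorProduct.AlgebraTensorModule.cancelBaseChange R Rm Rm k K).injective
    apply h1
    rw [← h2, ← h2, hxy]
  exact Module.Projective.of_equiv (LocalizedModule.equivTensorProduct m.primeCompl T).symm

end LocalCriterion

/-! ### Semidualizing modules as test objects, and the Picard relation -/

section Semidualizing

theorem LinearMap.eq_sum_smul_of_comp_eq_id {R M ι : Type*} [CommRing R] [AddCommGroup M]
    [Module R M] [Fintype ι] [DecidableEq ι] {f : (ι → R) →ₗ[R] M} {g : M →ₗ[R] (ι → R)}
    (h : f ∘ₗ g = LinearMap.id) (x : M) : x = ∑ a, g x a • f (Pi.single a 1) := by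
  have h2 := LinearMap.congr_fun h x
  rw [LinearMap.comp_apply, LinearMap.id_apply, pi_eq_sum_univ' (g x), map_sum] at h2
  conv_lhs => rw [← h2]
  refine Finset.sum_congr rfl fun a _ => ?_
  rw [map_smul]

variable {R : Type u} [CommRing R]

namespace IsSemidualizing

variable {B : ModuleCat.{u} R}

theorem annihilator_eq_bot (hB : IsSemidualizing B) : Module.annihilator R B = ⊥ := by
  refine eq_bot_iff.2 fun r hr => hB.homothety_bijective.1 ?_
  ext b
  exact (Module.mem_annihilator.1 hr b).trans (zero_smul R b).symm

/-- Over a Noetherian ring, Hom(B, N) = 0 for finite modules forces the annihilator of `B` to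
contain an `N`-regular element. That annihilator is zero, so 0 is regular on `N`. Kernels and
cokernels can therefore be tested by maps out of `B`. -/
theorem subsingleton_of_linearMap [IsNoetherianRing R] (hB : IsSemidualizing B) {N : Type u}
    [AddCommGroup N] [Module R N] [Module.Finite R N] (h : ∀ f : B →ₗ[R] N, f = 0) :
    Subsingleton N := by
  have := hB.finite
  have h1 : Subsingleton (B →ₗ[R] N) := ⟨fun f g => (h f).trans (h g).symm⟩
  obtain ⟨r, hr, hreg⟩ := IsSMulRegular.subsingleton_linearMap_iff.1 h1
  rw [hB.annihilator_eq_bot, Ideal.mem_bot] at hr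
  subst hr
  exact ⟨fun a b => hreg (by simp)⟩

/-- Hom(B, R/m) is nonzero, and a nonzero value in a field can be rescaled to 1. Evaluation at `b`
then splits the map R/m → Hom(B, R/m), c ↦ c f. -/
theorem exists_apply_eq_one [IsNoetherianRing R] (hB : IsSemidualizing B) (m : Ideal R)
    [m.IsMaximal] : ∃ (f : B →ₗ[R] (R ⧸ m)) (b : B), f b = 1 := by
  let : Field (R ⧸ m) := Ideal.Quotient.field m
  have h : ∃ f : B →ₗ[R] (R ⧸ m), f ≠ 0 := by
    by_contra! h
    exact not_subsingleton (R ⧸ m) (hB.subsingleton_of_linearMap h)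
  obtain ⟨f, hf⟩ := h
  obtain ⟨b, hb⟩ : ∃ b, f b ≠ 0 := by
    by_contra! hb
    exact hf (LinearMap.ext hb)
  obtain ⟨r, hr⟩ := Ideal.Quotient.mk_surjective (f b)⁻¹
  refine ⟨f, r • b, ?_⟩
  rw [map_smul, Algebra.smul_def]
  change Ideal.Quotient.mk m r * f b = 1
  rw [hr, inv_mul_cancel₀ hb]

end IsSemidualizing

/-- A short exact sequence `0 → N → X → Y → 0` with `Ext^1(B, N) = 0` has the lifting property
for maps out of `B`. -/
theorem exists_lift_of_subsingleton_ext {B : ModuleCat.{u} R} {N X Y : Type u}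
    [AddCommGroup N] [Module R N] [AddCommGroup X] [Module R X] [AddCommGroup Y] [Module R Y]
    (hN : Subsingleton (Abelian.Ext B (ModuleCat.of R N) 1)) (i : N →ₗ[R] X) (p : X →ₗ[R] Y)
    (hi : Function.Injective i) (hp : Function.Surjective p) (hip : Function.Exact i p)
    (f : B →ₗ[R] Y) : ∃ g : B →ₗ[R] X, p ∘ₗ g = f := by
  let S : ShortComplex (ModuleCat.{u} R) := ShortComplex.mk (ModuleCat.ofHom i) (ModuleCat.ofHom p)
    (by ext x; exact hip.apply_apply_eq_zero x)
  have hS : S.ShortExact :=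
    { exact := (ShortComplex.moduleCat_exact_iff S).2 fun x hx => (hip x).1 hx
      mono_f := (ModuleCat.mono_iff_injective _).2 hi
      epi_g := (ModuleCat.epi_iff_surjective _).2 hp }
  obtain ⟨x, hx⟩ := Abelian.Ext.covariant_sequence_exact₃ B hS
    (Abelian.Ext.mk₀ (ModuleCat.ofHom f : B ⟶ S.X₃)) (zero_add 1) (hN.elim _ _)
  obtain ⟨g, rfl⟩ := (Abelian.Ext.mk₀_bijective B S.X₂).2 x
  rw [Abelian.Ext.mk₀_comp_mk₀] at hx
  have h := (Abelian.Ext.mk₀_bijective B S.X₃).1 hx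
  exact ⟨g.hom, congrArg ModuleCat.Hom.hom h⟩

/-- As `T` is a summand of a finite free module, the identity of B ⊗ T is a sum of maps factoring
through `B`; every Ext class therefore passes through the vanishing group. -/
theorem subsingleton_ext_tensor {B : ModuleCat.{u} R} {T : Type u} [AddCommGroup T] [Module R T]
    [Module.Finite R T] [Module.Projective R T] (n : ℕ)
    (hB : Subsingleton (Abelian.Ext B B n)) :
    Subsingleton (Abelian.Ext B (ModuleCat.of R (B ⊗[R] T)) n) := by
  obtain ⟨l, f, g, -, -, hfg⟩ := Module.Finite.exists_comp_eq_id_of_projective R T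
  let r : Fin l → (ModuleCat.of R (B ⊗[R] T) ⟶ B) := fun a => ModuleCat.ofHom
    ((TensorProduct.rid R B).toLinearMap ∘ₗ (LinearMap.proj a ∘ₗ g).lTensor B)
  let s : Fin l → (B ⟶ ModuleCat.of R (B ⊗[R] T)) := fun a => ModuleCat.ofHom
    ((TensorProduct.mk R B T).flip (f (Pi.single a 1)))
  have hsum : 𝟙 (ModuleCat.of R (B ⊗[R] T)) = ∑ a, r a ≫ s a := by
    refine ModuleCat.hom_ext (TensorProduct.ext' fun b t => ?_)
    conv_lhs => rw [LinearMap.eq_sum_smul_of_comp_eq_id hfg t]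
    simp [r, s, ModuleCat.hom_sum, LinearMap.sum_apply, TensorProduct.tmul_sum]
  refine ⟨fun x y => ?_⟩
  have h0 : ∀ x : Abelian.Ext B (ModuleCat.of R (B ⊗[R] T)) n, x = 0 := by
    intro x
    rw [← Abelian.Ext.comp_mk₀_id x, hsum, Abelian.Ext.mk₀_sum, Abelian.Ext.comp_sum]
    refine Finset.sum_eq_zero fun a _ => ?_
    rw [← Abelian.Ext.mk₀_comp_mk₀, ← Abelian.Ext.comp_assoc_of_second_deg_zero,
      hB.elim (x.comp (Abelian.Ext.mk₀ (r a)) (add_zero n)) 0, Abelian.Ext.zero_comp]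
  rw [h0 x, h0 y]

/-- If `Hom(B, C)` is projective then `B ⊗ Hom(B, C) → C` is an isomorphism. -/
theorem bijective_eval_of_projective [IsNoetherianRing R] {B C : ModuleCat.{u} R}
    (hB : IsSemidualizing B) [Module.Finite R C] [Module.Projective R (B →ₗ[R] C)] :
    Function.Bijective (TensorProduct.lift (LinearMap.id (R := R) (M := B →ₗ[R] C)).flip) := by
  have := hB.finite
  set T := B →ₗ[R] C
  have : Module.Finite R T := inferInstanceAs (Module.Finite R (B →ₗ[R] C))
  set ev := TensorProduct.lift (LinearMap.id (R := R) (M := T)).flip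
  have hη := TensorProduct.mk_flip_bijective_of_projective (C := B) (P := T) hB.homothety_bijective
  have hevη : ∀ t : T, ev ∘ₗ (TensorProduct.mk R B T).flip t = t := fun t => by ext b; rfl
  have hinj : Function.Injective ev := by
    rw [← LinearMap.ker_eq_bot, ← Submodule.subsingleton_iff_eq_bot]
    -- A map from `B` to the kernel has the form b ↦ b ⊗ t, and `ev` sends it to `t`; hence t = 0.
    refine hB.subsingleton_of_linearMap fun f => ?_
    obtain ⟨t, ht⟩ := hη.2 ((LinearMap.ker ev).subtype ∘ₗ f)
    have h0 : t = 0 := by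
      rw [← hevη t, ht]
      ext b
      exact (f b).2
    ext b
    have := LinearMap.congr_fun ht b
    rw [h0] at this
    exact (this.symm.trans (by simp) : ((f b : _) : B ⊗[R] T) = 0)
  refine ⟨hinj, ?_⟩
  rw [← LinearMap.range_eq_top, ← Submodule.Quotient.subsingleton_iff]
  refine hB.subsingleton_of_linearMap fun f => ?_
  -- Ext^1(B, B ⊗ T) = 0 lifts a map from `B` to the cokernel to a map B → C, that is, to an element
  -- of `T`. Its values lie in the range of `ev`.
  obtain ⟨g, rfl⟩ := exists_lift_of_subsingleton_ext
    (subsingleton_ext_tensor 1 (hB.ext_eq_zero 1 one_pos)) ev (LinearMap.range ev).mkQ hinj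
    (Submodule.mkQ_surjective _) (LinearMap.exact_map_mkQ_range _) f
  rw [← hevη g]
  ext b
  exact (Submodule.Quotient.mk_eq_zero _).2 (LinearMap.mem_range.2 ⟨(TensorProduct.mk R B T).flip g b, rfl⟩)

/-- Composing the two evaluation isomorphisms gives B ≅ B ⊗ (Hom(B, C) ⊗ Hom(C, B)). Applying Hom(B,
-) cancels `B`, and multiplicativity of rank then forces rank one. -/
theorem PicEquivalent.of_projective_hom [IsNoetherianRing R] [Nontrivial R] {B C : ModuleCat.{u} R}
    (hB : IsSemidualizing B) (hC : IsSemidualizing C) (h₁ : Module.Projective R (B →ₗ[R] C))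
    (h₂ : Module.Projective R (C →ₗ[R] B)) : PicEquivalent B C := by
  have := hB.finite
  have := hC.finite
  have f₁ : Module.Finite R (B →ₗ[R] C) := inferInstance
  have f₂ : Module.Finite R (C →ₗ[R] B) := inferInstance
  let e₁ := LinearEquiv.ofBijective _ (bijective_eval_of_projective (C := C) hB)
  let e₂ := LinearEquiv.ofBijective _ (bijective_eval_of_projective (C := B) hC)
  let e : (B ⊗[R] ((B →ₗ[R] C) ⊗[R] (C →ₗ[R] B))) ≃ₗ[R] B :=
    (TensorProduct.assoc R _ _ _).symm ≪≫ₗ TensorProduct.congr e₁ (LinearEquiv.refl R _) ≪≫ₗ e₂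
  let e' : ((B →ₗ[R] C) ⊗[R] (C →ₗ[R] B)) ≃ₗ[R] R :=
    LinearEquiv.ofBijective _ (TensorProduct.mk_flip_bijective_of_projective (C := B)
      (P := (B →ₗ[R] C) ⊗[R] (C →ₗ[R] B)) hB.homothety_bijective) ≪≫ₗ
    LinearEquiv.congrRight e ≪≫ₗ (LinearEquiv.ofBijective _ hB.homothety_bijective).symm
  refine ⟨ModuleCat.of R (B →ₗ[R] C), f₁, h₁, fun p => ?_, ⟨e₁.symm⟩⟩
  have h := congrFun ((Module.rankAtStalk_tensorProduct (R := R) (M := B →ₗ[R] C) (C →ₗ[R] B)).symm.trans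
    ((Module.rankAtStalk_eq_of_equiv e').trans Module.rankAtStalk_self)) p
  exact Nat.eq_one_of_mul_eq_one_right h

/-- If `C ≅ B ⊗ P` with `P` of rank one, then `B` is a direct summand of a finite power of `C`. -/
theorem PicEquivalent.exists_sum_eq_id {B C : ModuleCat.{u} R} (h : PicEquivalent B C) :
    ∃ (l : ℕ) (r : Fin l → (B →ₗ[R] C)) (s : Fin l → (C →ₗ[R] B)),
      ∑ a, s a ∘ₗ r a = LinearMap.id := by
  obtain ⟨P, hf, hproj, hrank, ⟨e⟩⟩ := h
  obtain ⟨n, f, g, -, -, hfg⟩ := Module.Finite.exists_comp_eq_id_of_projective R P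
  -- The trace ideal of `P`. If it lay in a maximal ideal `m`, the dual basis would give P = mP, and
  -- Nakayama's lemma an element outside `m` killing `P`, against rank one at `m`.
  let J : Ideal R := Submodule.span R {x | ∃ (φ : P →ₗ[R] R) (p : P), φ p = x}
  have hJ : J = ⊤ := by
    by_contra hne
    obtain ⟨m, hm, hJm⟩ := Ideal.exists_le_maximal J hne
    have hle : (⊤ : Submodule R P) ≤ m • ⊤ := by
      intro p _
      have h1 := LinearMap.eq_sum_smul_of_comp_eq_id hfg p
      rw [h1]
      exact Submodule.sum_mem _ fun a _ => Submodule.smul_mem_smul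
        (hJm (Submodule.subset_span ⟨LinearMap.proj a ∘ₗ g, p, rfl⟩)) trivial
    obtain ⟨r, hr, hr0⟩ := Submodule.exists_sub_one_mem_and_smul_eq_zero_of_fg_of_le_smul m ⊤
      Module.Finite.fg_top hle
    have hsupp : (⟨m, hm.isPrime⟩ : PrimeSpectrum R) ∈ Module.support R P :=
      (Module.rankAtStalk_pos_iff_mem_support _).1 (by rw [hrank]; exact one_pos)
    have hrm : r ∈ m := Module.mem_support_iff_of_finite.1 hsupp
      (Module.mem_annihilator.2 fun p => hr0 p trivial)
    exact hm.ne_top ((Ideal.eq_top_iff_one m).2 (by simpa using m.sub_mem hrm hr))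
  have h1 : (1 : R) ∈ Submodule.span R {x | ∃ (φ : P →ₗ[R] R) (p : P), φ p = x} := by
    change (1 : R) ∈ J
    rw [hJ]; trivial
  have key : ∀ x ∈ Submodule.span R {x | ∃ (φ : P →ₗ[R] R) (p : P), φ p = x},
      ∃ (l : ℕ) (φ : Fin l → (P →ₗ[R] R)) (p : Fin l → P), ∑ a, φ a (p a) = x := by
    intro x hx
    induction hx using Submodule.span_induction with
    | mem x hx =>
      obtain ⟨φ, p, rfl⟩ := hx
      exact ⟨1, fun _ => φ, fun _ => p, by simp⟩
    | zero => exact ⟨0, fun _ => 0, fun _ => 0, by simp⟩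
    | add x y _ _ hx hy =>
      obtain ⟨l, φ, p, rfl⟩ := hx
      obtain ⟨l', φ', p', rfl⟩ := hy
      exact ⟨l + l', Fin.append φ φ', Fin.append p p', by simp [Fin.sum_univ_add]⟩
    | smul r x _ hx =>
      obtain ⟨l, φ, p, rfl⟩ := hx
      exact ⟨l, fun a => r • φ a, p, by simp [Finset.mul_sum]⟩
  obtain ⟨l, φ, p, hl⟩ := key 1 h1
  -- From ∑ φ_a(p_a) = 1, the maps b ↦ b ⊗ p_a and 1 ⊗ φ_a compose and sum to the identity of `B`.
  refine ⟨l, fun a => e.symm.toLinearMap ∘ₗ (TensorProduct.mk R B P).flip (p a), fun a =>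
    (TensorProduct.rid R B).toLinearMap ∘ₗ (φ a).lTensor B ∘ₗ e.toLinearMap, ?_⟩
  ext b
  simp [LinearMap.sum_apply, ← Finset.sum_smul, hl]

end Semidualizing

/-! ### Resolutions from exact augmented complexes -/

namespace CategoryTheory

variable {A : Type*} [Category* A] [Abelian A]

/-- A projective resolution from exactness of the augmented complex. -/
def ProjectiveResolution.ofExact {Z : A} (K : ChainComplex A ℕ) (hK : ∀ n, Projective (K.X n))
    (π : K.X 0 ⟶ Z) (w : K.d 1 0 ≫ π = 0) (h₀ : (ShortComplex.mk (K.d 1 0) π w).Exact)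
    (hπ : Epi π) (hs : ∀ n, K.ExactAt (n + 1)) : ProjectiveResolution Z where
  complex := K
  projective := hK
  π := (ChainComplex.toSingle₀Equiv _ _).symm ⟨π, w⟩
  quasiIso := ⟨fun n => by
    cases n
    · rw [ChainComplex.quasiIsoAt₀_iff, ShortComplex.quasiIso_iff_of_zeros']
      · refine (ShortComplex.exact_and_epi_g_iff_of_iso ?_).2 ⟨h₀, hπ⟩
        exact ShortComplex.isoMk (Iso.refl _) (Iso.refl _) (Iso.refl _)
          (by simp; exact (Category.id_comp _).trans (Category.comp_id _).symm)
          (by simp; exact (Category.id_comp _).trans (Category.comp_id _).symm)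
      all_goals first | rfl | exact K.shape _ _ (by simp)
    · rw [quasiIsoAt_iff_exactAt']
      · exact hs _
      · apply ChainComplex.exactAt_succ_single_obj⟩

/-- An injective resolution from exactness of the coaugmented complex. -/
def InjectiveResolution.ofExact {Z : A} (K : CochainComplex A ℕ) (hK : ∀ n, Injective (K.X n))
    (ι : Z ⟶ K.X 0) (w : ι ≫ K.d 0 1 = 0) (h₀ : (ShortComplex.mk ι (K.d 0 1) w).Exact)
    (hι : Mono ι) (hs : ∀ n, K.ExactAt (n + 1)) : InjectiveResolution Z where
  cocomplex := K
  injective := hK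
  ι := (CochainComplex.fromSingle₀Equiv _ _).symm ⟨ι, w⟩
  quasiIso := ⟨fun n => by
    cases n
    · rw [CochainComplex.quasiIsoAt₀_iff, ShortComplex.quasiIso_iff_of_zeros]
      · refine (ShortComplex.exact_and_mono_f_iff_of_iso ?_).2 ⟨h₀, hι⟩
        exact ShortComplex.isoMk (Iso.refl _) (Iso.refl _) (Iso.refl _)
          (by simp; exact (Category.id_comp _).trans (Category.comp_id _).symm)
          (by simp; exact (Category.id_comp _).trans (Category.comp_id _).symm)
      all_goals first | rfl | exact K.shape _ _ (by simp)
    · rw [quasiIsoAt_iff_exactAt]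
      · exact hs _
      · apply CochainComplex.exactAt_succ_single_obj⟩

end CategoryTheory

variable {R : Type u} [CommRing R]

/-! ### P_C-relative Ext as Ext of Hom(C, -) -/

section HomSide

/-- The functor `Hom(C, -)`. -/
abbrev homFunctor (C : ModuleCat.{u} R) : ModuleCat.{u} R ⥤ ModuleCat.{u} R :=
  (linearCoyoneda R (ModuleCat.{u} R)).obj (op C)

instance (C : ModuleCat.{u} R) : (homFunctor C).Linear R where
  map_smul f r := by
    refine ModuleCat.hom_ext (LinearMap.ext fun g => ?_)
    exact Linear.comp_smul _ _ _ g r f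

theorem homFunctor_exactAt_iff (C : ModuleCat.{u} R) (K : ChainComplex (ModuleCat.{u} R) ℕ)
    (i j k : ℕ) (hi : (ComplexShape.down ℕ).prev j = i) (hk : (ComplexShape.down ℕ).next j = k) :
    (((homFunctor C).mapHomologicalComplex (ComplexShape.down ℕ)).obj K).ExactAt j ↔
      ∀ g : C ⟶ K.X j, g ≫ K.d j k = 0 → ∃ g' : C ⟶ K.X i, g' ≫ K.d i j = g := by
  rw [HomologicalComplex.exactAt_iff' _ i j k hi hk, ShortComplex.moduleCat_exact_iff]
  exact Iff.rfl

theorem IsCProjective.projective_hom {C X : ModuleCat.{u} R} (hC : IsSemidualizing C)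
    (hX : IsCProjective C X) : Projective ((homFunctor C).obj X) := by
  obtain ⟨P, hP, ⟨e⟩⟩ := hX
  have := hC.finite
  rw [← IsProjective.iff_projective]
  exact Module.Projective.of_equiv (LinearEquiv.ofBijective _
    (TensorProduct.mk_flip_bijective_of_projective (C := C) (P := P) hC.homothety_bijective) ≪≫ₗ
      LinearEquiv.congrRight e.symm ≪≫ₗ (ModuleCat.homLinearEquiv (S := R)).symm)

/-- For X = C ⊗ P, adjunction gives Hom(C ⊗ P, N) ≅ Hom(P, Hom(C, N)), and the unit identifies P
with Hom(C, X). -/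
theorem IsCProjective.map_bijective {C X : ModuleCat.{u} R} (hC : IsSemidualizing C)
    (hX : IsCProjective C X) (N : ModuleCat.{u} R) :
    Function.Bijective (fun f : X ⟶ N => (homFunctor C).map f) := by
  obtain ⟨P, hP, ⟨e⟩⟩ := hX
  have := hC.finite
  have hη := TensorProduct.mk_flip_bijective_of_projective (C := C) (P := P) hC.homothety_bijective
  let η : P → (C ⟶ X) := fun p => ModuleCat.ofHom
    (e.symm.toLinearMap ∘ₗ (TensorProduct.mk R C P).flip p)
  have hη' : ∀ g : C ⟶ X, ∃ p, η p = g := by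
    intro g
    obtain ⟨p, hp⟩ := hη.2 (e.toLinearMap ∘ₗ g.hom)
    refine ⟨p, ModuleCat.hom_ext ?_⟩
    ext c
    simp [η, hp]
  constructor
  · intro f g hfg
    have h : ∀ p c, f.hom (e.symm (c ⊗ₜ p)) = g.hom (e.symm (c ⊗ₜ p)) := fun p c => by
      have h1 : η p ≫ f = η p ≫ g :=
        congrArg (fun h : (homFunctor C).obj X ⟶ (homFunctor C).obj N => h.hom (η p)) hfg
      exact congrArg (fun h : C ⟶ N => h.hom c) h1
    have h2 : f.hom ∘ₗ e.symm.toLinearMap = g.hom ∘ₗ e.symm.toLinearMap :=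
      TensorProduct.ext' fun c p => h p c
    refine ModuleCat.hom_ext (LinearMap.ext fun x => ?_)
    have := LinearMap.congr_fun h2 (e x)
    simpa using this
  · intro h
    let ηl : P →ₗ[R] (C ⟶ X) := (ModuleCat.homLinearEquiv (S := R)).symm.toLinearMap ∘ₗ
      e.symm.toLinearMap.compRight R ∘ₗ (TensorProduct.mk R C P).flip
    let t : P →ₗ[R] C →ₗ[R] N :=
      (ModuleCat.homLinearEquiv (S := R)).toLinearMap ∘ₗ h.hom ∘ₗ ηl
    let f : X ⟶ N := ModuleCat.ofHom (TensorProduct.lift t.flip ∘ₗ e.toLinearMap)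
    refine ⟨f, ModuleCat.hom_ext (LinearMap.ext fun g => ?_)⟩
    obtain ⟨p, rfl⟩ := hη' g
    refine ModuleCat.hom_ext (LinearMap.ext fun c => ?_)
    change TensorProduct.lift t.flip (e (e.symm (c ⊗ₜ p))) = _
    rw [LinearEquiv.apply_symm_apply]
    rfl

namespace ProperPResolution

variable {C M : ModuleCat.{u} R} (X : ProperPResolution C M)

/-- `Hom(C, X)` is a projective resolution of `Hom(C, M)`. -/
def homResolution (hC : IsSemidualizing C) : ProjectiveResolution ((homFunctor C).obj M) :=
  ProjectiveResolution.ofExact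
    (((homFunctor C).mapHomologicalComplex (ComplexShape.down ℕ)).obj X.complex)
    (fun n => (X.isCProjective n).projective_hom hC) ((homFunctor C).map X.π)
    (by
      change (homFunctor C).map _ ≫ _ = 0
      rw [← Functor.map_comp, X.d_comp_π, Functor.map_zero])
    -- Augmenting shifts degrees by one: degree 0 of the augmented complex is `M`, degree n + 1 is
    -- `X_n`.
    ((ShortComplex.moduleCat_exact_iff _).2
      ((homFunctor_exactAt_iff C _ 2 1 0 (by simp) (by simp)).1 (X.exact 1)))
    ((ModuleCat.epi_iff_surjective _).2 fun g =>
      (homFunctor_exactAt_iff C _ 1 0 0 (by simp) (by simp)).1 (X.exact 0) g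
        Limits.comp_zero)
    (fun n => (homFunctor_exactAt_iff C _ (n + 2) (n + 1) n (by simp) (by simp)).2
      ((homFunctor_exactAt_iff C _ (n + 3) (n + 2) (n + 1) (by simp) (by simp)).1
        (X.exact (n + 2))))

/-- `Hom(X, N) ≅ Hom(Hom(C, X), Hom(C, N))`. -/
def linearYonedaObjIso (hC : IsSemidualizing C) (N : ModuleCat.{u} R) :
    X.complex.linearYonedaObj R N ≅
      (X.homResolution hC).complex.linearYonedaObj R ((homFunctor C).obj N) :=
  HomologicalComplex.Hom.isoOfComponents
    (fun n => (LinearEquiv.ofBijective ((homFunctor C).mapLinearMap R)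
      ((X.isCProjective n).map_bijective hC N)).toModuleIso)
    (fun i j _ => by
      refine ModuleCat.hom_ext (LinearMap.ext fun f => ?_)
      exact ((homFunctor C).map_comp (X.complex.d j i) f).symm)

/-- Relative cohomology is the cohomology of `Hom(Q, Hom(C, N))` for any projective resolution `Q`
of `Hom(C, M)`. -/
def homologyIso (hC : IsSemidualizing C) (Q : ProjectiveResolution ((homFunctor C).obj M))
    (N : ModuleCat.{u} R) (n : ℕ) : (X.complex.linearYonedaObj R N).homology n ≅
      (Q.complex.linearYonedaObj R ((homFunctor C).obj N)).homology n :=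
  HomologicalComplex.homologyMapIso (X.linearYonedaObjIso hC N) n ≪≫
    ((X.homResolution hC).isoExt n _).symm ≪≫ Q.isoExt n _

end ProperPResolution

theorem IsCProjective.of_picEquivalent {B C X : ModuleCat.{u} R} (h : PicEquivalent B C)
    (hX : IsCProjective C X) : IsCProjective B X := by
  obtain ⟨P, -, hP, -, ⟨e⟩⟩ := h
  obtain ⟨Q, hQ, ⟨e'⟩⟩ := hX
  exact ⟨ModuleCat.of R (P ⊗[R] Q), inferInstanceAs (Module.Projective R (P ⊗[R] Q)),
    ⟨e' ≪≫ₗ TensorProduct.congr e (LinearEquiv.refl R Q) ≪≫ₗ TensorProduct.assoc R B P Q⟩⟩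

/-- A proper `P_C`-resolution is a proper `P_B`-resolution if `C ≅ B ⊗ P`, `P` of rank one. -/
def ProperPResolution.ofPicEquivalent {B C M : ModuleCat.{u} R} (h : PicEquivalent B C)
    (X : ProperPResolution C M) : ProperPResolution B M where
  complex := X.complex
  isCProjective n := (X.isCProjective n).of_picEquivalent h
  π := X.π
  d_comp_π := X.d_comp_π
  exact j := by
    obtain ⟨l, r, s, hrs⟩ := h.exists_sum_eq_id
    have hid : 𝟙 B = ∑ a, ModuleCat.ofHom (r a) ≫ ModuleCat.ofHom (s a) := by
      refine ModuleCat.hom_ext ?_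
      rw [ModuleCat.hom_id, ← hrs, ModuleCat.hom_sum]
      rfl
    refine (homFunctor_exactAt_iff B _ _ j _ rfl rfl).2 fun g hg => ?_
    have hC := (homFunctor_exactAt_iff C _ _ j _ rfl rfl).1 (X.exact j)
    -- Composing the cycle `g` with each `s a` gives a cycle on `C`, which lifts; the lifts
    -- recombine through the `r a`.
    choose g' hg' using fun a => hC (ModuleCat.ofHom (s a) ≫ g)
      (by rw [Category.assoc, hg, Limits.comp_zero])
    refine ⟨∑ a, ModuleCat.ofHom (r a) ≫ g' a, ?_⟩
    rw [Preadditive.sum_comp, ← Category.id_comp g, hid, Preadditive.sum_comp]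
    refine Finset.sum_congr rfl fun a _ => ?_
    rw [Category.assoc, Category.assoc, hg']

theorem relExtP_equiv_of_picEquivalent {B C : ModuleCat.{u} R} (hB : IsSemidualizing B)
    (h : PicEquivalent B C) (M N : ModuleCat.{u} R) (i : ℕ) :
    Nonempty (relExtP C M N i ≃ₗ[R] relExtP B M N i) := by
  -- The underlying complex is unchanged, so its cohomology is still the relative Ext of `C`, now
  -- computed as that of `B`.
  let X := (ProperPResolution.nonempty C M).some.ofPicEquivalent h
  let X' := (ProperPResolution.nonempty B M).some
  exact ⟨(X.homologyIso hB (X'.homResolution hB) N i ≪≫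
    (X'.homologyIso hB (X'.homResolution hB) N i).symm).toLinearEquiv⟩

end HomSide

/-! ### I_C-relative Ext as Ext of C ⊗ - -/

section TensorSide

/-- The functor `C ⊗ -`. -/
abbrev tensorFunctor (C : ModuleCat.{u} R) : ModuleCat.{u} R ⥤ ModuleCat.{u} R :=
  MonoidalCategory.tensorLeft C

theorem tensorFunctor_exactAt_iff (C : ModuleCat.{u} R) (K : CochainComplex (ModuleCat.{u} R) ℕ)
    (i j k : ℕ) (hi : (ComplexShape.up ℕ).prev j = i) (hk : (ComplexShape.up ℕ).next j = k) :
    (((tensorFunctor C).mapHomologicalComplex (ComplexShape.up ℕ)).obj K).ExactAt j ↔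
      ∀ x : (C ⊗[R] K.X j), (K.d j k).hom.lTensor C x = 0 →
        ∃ y : (C ⊗[R] K.X i), (K.d i j).hom.lTensor C y = x := by
  rw [HomologicalComplex.exactAt_iff' _ i j k hi hk, ShortComplex.moduleCat_exact_iff]
  exact Iff.rfl

theorem Module.Injective.linearMap_of_flat {P I : Type u} [AddCommGroup P] [Module R P]
    [AddCommGroup I] [Module R I] [Module.Flat R P] [Module.Injective R I] :
    Module.Injective R (P →ₗ[R] I) where
  out X Y _ _ _ _ f hf g := by
    obtain ⟨h, hh⟩ := Module.Injective.out (f.rTensor P)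
      (Module.Flat.rTensor_preserves_injective_linearMap f hf) (TensorProduct.lift g)
    refine ⟨TensorProduct.curry h, fun x => ?_⟩
    ext p
    simpa using hh (x ⊗ₜ p)

/-- If `C` is semidualizing and `I` is injective then `C ⊗ Hom(C, I) ≅ I`. -/
theorem IsSemidualizing.eval_bijective [IsNoetherianRing R] {C : ModuleCat.{u} R}
    (hC : IsSemidualizing C) (I : Type u) [AddCommGroup I] [Module R I] [Module.Injective R I] :
    Function.Bijective
      (TensorProduct.lift (LinearMap.id (R := R) (M := C →ₗ[R] I)).flip) := by
  have := hC.finite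
  -- The evaluation factors as C ⊗ Hom(C, I) ≅ Hom(Hom(C, C), I) ≅ Hom(R, I) ≅ I.
  let e : R ≃ₗ[R] (C →ₗ[R] C) := LinearEquiv.ofBijective _ hC.homothety_bijective
  let e' : ((C →ₗ[R] C) →ₗ[R] I) ≃ₗ[R] I :=
    LinearEquiv.congrLeft I R e.symm ≪≫ₗ LinearMap.ringLmapEquivSelf R R I
  have h : TensorProduct.lift (LinearMap.id (R := R) (M := C →ₗ[R] I)).flip =
      e'.toLinearMap ∘ₗ tensorHomEval R C C I := by
    apply TensorProduct.ext'
    intro c φ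
    simp [e', e, LinearEquiv.congrLeft]
  rw [h]
  exact e'.bijective.comp tensorHomEval_bijective

/-- The evaluation isomorphism `C ⊗ X ≅ I` when `X ≅ Hom(C, I)`. -/
def IsSemidualizing.tensorEquiv [IsNoetherianRing R] {C X : ModuleCat.{u} R}
    (hC : IsSemidualizing C) {I : Type u} [AddCommGroup I] [Module R I] [Module.Injective R I]
    (e : X ≃ₗ[R] (C →ₗ[R] I)) : (C ⊗[R] X) ≃ₗ[R] I :=
  LinearEquiv.lTensor C e ≪≫ₗ LinearEquiv.ofBijective _ (hC.eval_bijective I)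

@[simp]
theorem IsSemidualizing.tensorEquiv_tmul [IsNoetherianRing R] {C X : ModuleCat.{u} R}
    (hC : IsSemidualizing C) {I : Type u} [AddCommGroup I] [Module R I] [Module.Injective R I]
    (e : X ≃ₗ[R] (C →ₗ[R] I)) (c : C) (x : X) : hC.tensorEquiv e (c ⊗ₜ x) = e x c := rfl

theorem IsCInjective.injective_tensor [IsNoetherianRing R] {C X : ModuleCat.{u} R}
    (hC : IsSemidualizing C) (hX : IsCInjective C X) : Injective ((tensorFunctor C).obj X) := by
  obtain ⟨I, hI, ⟨e⟩⟩ := hX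
  have hI' : Injective (ModuleCat.of R I) := (Module.injective_iff_injective_object R I).1 hI
  exact Injective.of_iso
    (show ModuleCat.of R I ≅ ModuleCat.of R (C ⊗[R] X) from (hC.tensorEquiv e).symm.toModuleIso) hI'

/-- For X = Hom(C, I), adjunction gives Hom(M, X) ≅ Hom(C ⊗ M, I), and evaluation identifies C ⊗ X
with I. -/
theorem IsCInjective.map_bijective [IsNoetherianRing R] {C X : ModuleCat.{u} R}
    (hC : IsSemidualizing C) (hX : IsCInjective C X) (M : ModuleCat.{u} R) :
    Function.Bijective (fun f : M ⟶ X => (tensorFunctor C).map f) := by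
  obtain ⟨I, hI, ⟨e⟩⟩ := hX
  constructor
  · intro f g hfg
    refine ModuleCat.hom_ext (LinearMap.ext fun m => e.injective (LinearMap.ext fun c => ?_))
    have h : f.hom.lTensor C (c ⊗ₜ m) = g.hom.lTensor C (c ⊗ₜ m) :=
      congrArg (fun h : (tensorFunctor C).obj M ⟶ (tensorFunctor C).obj X =>
        (show C ⊗[R] X from h.hom (show C ⊗[R] M from c ⊗ₜ m))) hfg
    exact congrArg (hC.tensorEquiv e) h
  · intro h
    let h' : (C ⊗[R] M) →ₗ[R] (C ⊗[R] X) := h.hom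
    let f : M →ₗ[R] X := e.symm.toLinearMap ∘ₗ
      (TensorProduct.curry ((hC.tensorEquiv e).toLinearMap ∘ₗ h')).flip
    have hf : f.lTensor C = h' := by
      apply TensorProduct.ext'
      intro c m
      apply (hC.tensorEquiv e).injective
      simp [f]
    exact ⟨ModuleCat.ofHom f, ModuleCat.hom_ext hf⟩

/-- Two injective resolutions compute the same cohomology. -/
def CategoryTheory.InjectiveResolution.homologyIso (M : ModuleCat.{u} R) {V : ModuleCat.{u} R}
    (I J : InjectiveResolution V) (n : ℕ) :
    (((homFunctor M).mapHomologicalComplex (ComplexShape.up ℕ)).obj I.cocomplex).homology n ≅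
      (((homFunctor M).mapHomologicalComplex (ComplexShape.up ℕ)).obj J.cocomplex).homology n :=
  ((homFunctor M).mapHomotopyEquiv (I.homotopyEquiv J)).toHomologyIso n

namespace ProperIResolution

variable {C N : ModuleCat.{u} R} (Y : ProperIResolution C N)

/-- `C ⊗ Y` is an injective resolution of `C ⊗ N`. -/
def tensorResolution [IsNoetherianRing R] (hC : IsSemidualizing C) :
    InjectiveResolution ((tensorFunctor C).obj N) :=
  InjectiveResolution.ofExact
    (((tensorFunctor C).mapHomologicalComplex (ComplexShape.up ℕ)).obj Y.cocomplex)
    (fun n => (Y.isCInjective n).injective_tensor hC) ((tensorFunctor C).map Y.ι)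
    (by
      change (tensorFunctor C).map Y.ι ≫ (tensorFunctor C).map _ = 0
      rw [← Functor.map_comp, Y.ι_comp_d, Functor.map_zero])
    ((ShortComplex.moduleCat_exact_iff _).2
      ((tensorFunctor_exactAt_iff C _ 0 1 2 (by simp) (by simp)).1 (Y.exact 1)))
    ((ModuleCat.mono_iff_injective _).2 (by
      have h := (tensorFunctor_exactAt_iff C _ 0 0 1 (by simp) (by simp)).1 (Y.exact 0)
      have h' : ∀ x : C ⊗[R] N, Y.ι.hom.lTensor C x = 0 → x = 0 := fun x hx => by
        obtain ⟨y, hy⟩ := h x hx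
        -- In degree 0 the predecessor is 0 itself, and the differential from 0 to 0 vanishes;
        -- exactness there says that C ⊗ N → C ⊗ Y⁰ is injective.
        rw [← hy, HomologicalComplex.shape _ _ _ (by simp)]
        exact congrArg (fun φ : (C ⊗[R] N) →ₗ[R] (C ⊗[R] N) => φ y) (LinearMap.lTensor_zero C)
      exact (injective_iff_map_eq_zero (Y.ι.hom.lTensor C)).2 h'))
    (fun n => (tensorFunctor_exactAt_iff C _ n (n + 1) (n + 2) (by simp) (by simp)).2
      ((tensorFunctor_exactAt_iff C _ (n + 1) (n + 2) (n + 3) (by simp) (by simp)).1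
        (Y.exact (n + 2))))

/-- `Hom(M, Y) ≅ Hom(C ⊗ M, C ⊗ Y)`. -/
def homComplexIso [IsNoetherianRing R] (hC : IsSemidualizing C) (M : ModuleCat.{u} R) :
    ((homFunctor M).mapHomologicalComplex (ComplexShape.up ℕ)).obj Y.cocomplex ≅
      ((homFunctor ((tensorFunctor C).obj M)).mapHomologicalComplex (ComplexShape.up ℕ)).obj
        (Y.tensorResolution hC).cocomplex :=
  HomologicalComplex.Hom.isoOfComponents
    (fun n => (LinearEquiv.ofBijective ((tensorFunctor C).mapLinearMap R)
      ((Y.isCInjective n).map_bijective hC M)).toModuleIso)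
    (fun i j _ => by
      refine ModuleCat.hom_ext (LinearMap.ext fun f => ?_)
      exact ((tensorFunctor C).map_comp f (Y.cocomplex.d i j)).symm)

/-- Relative cohomology is the cohomology of `Hom(C ⊗ M, J)` for any injective resolution `J`
of `C ⊗ N`. -/
def homologyIso [IsNoetherianRing R] (hC : IsSemidualizing C)
    (J : InjectiveResolution ((tensorFunctor C).obj N)) (M : ModuleCat.{u} R) (n : ℕ) :
    (((homFunctor M).mapHomologicalComplex (ComplexShape.up ℕ)).obj Y.cocomplex).homology n ≅
      (((homFunctor ((tensorFunctor C).obj M)).mapHomologicalComplex (ComplexShape.up ℕ)).obj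
        J.cocomplex).homology n :=
  HomologicalComplex.homologyMapIso (Y.homComplexIso hC M) n ≪≫
    (Y.tensorResolution hC).homologyIso _ J n

end ProperIResolution

theorem IsCInjective.of_picEquivalent {B C X : ModuleCat.{u} R} (h : PicEquivalent B C)
    (hX : IsCInjective C X) : IsCInjective B X := by
  obtain ⟨P, -, hP, -, ⟨e⟩⟩ := h
  obtain ⟨I, hI, ⟨e'⟩⟩ := hX
  exact ⟨ModuleCat.of R (P →ₗ[R] I), Module.Injective.linearMap_of_flat,
    ⟨e' ≪≫ₗ LinearEquiv.congrLeft I R e ≪≫ₗ (TensorProduct.lift.equiv (.id R) B P I).symm⟩⟩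

/-- A proper `I_C`-resolution is a proper `I_B`-resolution if `C ≅ B ⊗ P`, `P` of rank one. -/
def ProperIResolution.ofPicEquivalent {B C N : ModuleCat.{u} R} (h : PicEquivalent B C)
    (Y : ProperIResolution C N) : ProperIResolution B N where
  cocomplex := Y.cocomplex
  isCInjective n := (Y.isCInjective n).of_picEquivalent h
  ι := Y.ι
  ι_comp_d := Y.ι_comp_d
  exact j := by
    obtain ⟨l, r, s, hrs⟩ := h.exists_sum_eq_id
    have hcomm : ∀ {A A' : Type u} [AddCommGroup A] [Module R A] [AddCommGroup A'] [Module R A']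
        {X X' : Type u} [AddCommGroup X] [Module R X] [AddCommGroup X'] [Module R X']
        (f : A →ₗ[R] A') (g : X →ₗ[R] X') (x : A ⊗[R] X),
        g.lTensor A' (f.rTensor X x) = f.rTensor X' (g.lTensor A x) := by
      intros
      rw [← LinearMap.comp_apply, ← LinearMap.comp_apply, LinearMap.lTensor_comp_rTensor,
        LinearMap.rTensor_comp_lTensor]
    refine (tensorFunctor_exactAt_iff B _ _ j _ rfl rfl).2 fun x hx => ?_
    have hC := (tensorFunctor_exactAt_iff C _ _ j _ rfl rfl).1 (Y.exact j)
    choose y hy using fun a => hC ((r a).rTensor _ x) (by rw [hcomm, hx, map_zero])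
    refine ⟨∑ a, (s a).rTensor _ (y a), ?_⟩
    rw [map_sum]
    have hx' : x = ∑ a, (s a).rTensor _ ((r a).rTensor _ x) := by
      conv_lhs => rw [← LinearMap.rTensor_id_apply _ _ x, ← hrs]
      simp only [← LinearMap.comp_apply, ← LinearMap.rTensor_comp]
      rw [← LinearMap.sum_apply]
      congr 1
      exact map_sum (LinearMap.rTensorHom (R := R) _) _ _
    rw [hx']
    refine Finset.sum_congr rfl fun a _ => ?_
    rw [hcomm, hy]

theorem relExtI_equiv_of_picEquivalent [IsNoetherianRing R] {B C : ModuleCat.{u} R}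
    (hB : IsSemidualizing B) (h : PicEquivalent B C) (M N : ModuleCat.{u} R) (i : ℕ) :
    Nonempty (relExtI C M N i ≃ₗ[R] relExtI B M N i) := by
  let Y := (ProperIResolution.nonempty C N).some.ofPicEquivalent h
  let Y' := (ProperIResolution.nonempty B N).some
  exact ⟨(Y.homologyIso hB (Y'.tensorResolution hB) M i ≪≫
    (Y'.homologyIso hB (Y'.tensorResolution hB) M i).symm).toLinearEquiv⟩

end TensorSide

/-! ### From vanishing of relative Ext to projectivity of Hom(B, C) -/

section Converse

/-- If `Ext^1(T, N) = 0`, computed by a projective resolution `Q` of `T`, then maps to `N` extend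
from the kernel of any surjection `F → T` with `F` projective. -/
theorem exists_extension_of_isZero_homology {T : ModuleCat.{u} R} (Q : ProjectiveResolution T)
    (N : ModuleCat.{u} R) (hQ : Limits.IsZero ((Q.complex.linearYonedaObj R N).homology 1))
    {F : Type u} [AddCommGroup F] [Module R F] [Module.Projective R F] (p : F →ₗ[R] T)
    (hp : Function.Surjective p) (φ : LinearMap.ker p →ₗ[R] N) :
    ∃ ψ : F →ₗ[R] N, ∀ k : LinearMap.ker p, ψ k = φ k := by
  have hex : ∀ z : Q.complex.X 1 ⟶ N, Q.complex.d 2 1 ≫ z = 0 →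
      ∃ w : Q.complex.X 0 ⟶ N, Q.complex.d 1 0 ≫ w = z := by
    have h := (HomologicalComplex.exactAt_iff_isZero_homology _ _).2 hQ
    rw [HomologicalComplex.exactAt_iff' _ 0 1 2 (by simp) (by simp),
      ShortComplex.moduleCat_exact_iff] at h
    exact h
  let π : Q.complex.X 0 →ₗ[R] T := (Q.π.f 0).hom
  have hπ : Function.Surjective π := (ModuleCat.epi_iff_surjective (Q.π.f 0)).1 inferInstance
  have hπd : ∀ x, π x = 0 → ∃ y, (Q.complex.d 1 0).hom y = x :=
    (ShortComplex.moduleCat_exact_iff _).1 Q.exact₀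
  have hdπ : ∀ y, π ((Q.complex.d 1 0).hom y) = 0 := fun y =>
    congrArg (fun f => f.hom y) Q.complex_d_comp_π_f_zero
  have hQ0 : Module.Projective R (Q.complex.X 0) :=
    (IsProjective.iff_projective (R := R) (P := Q.complex.X 0)).2 (Q.projective 0)
  -- Comparison maps over `T` in both directions; 1 - ba takes values in the kernel of `p`. The
  -- cocycle φ ∘ b ∘ d is a coboundary w ∘ d, and ψ = w ∘ a + φ ∘ (1 - ba) extends `φ`.
  obtain ⟨a, ha⟩ := Module.projective_lifting_property π p hπ
  obtain ⟨b, hb⟩ := Module.projective_lifting_property p π hp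
  have ha' : ∀ x, π (a x) = p x := fun x => LinearMap.congr_fun ha x
  have hb' : ∀ x, p (b x) = π x := fun x => LinearMap.congr_fun hb x
  let bd : Q.complex.X 1 →ₗ[R] LinearMap.ker p := LinearMap.codRestrict _
    (b ∘ₗ (Q.complex.d 1 0).hom) fun y => by
      rw [LinearMap.mem_ker, LinearMap.comp_apply, hb', hdπ]
  let c : F →ₗ[R] LinearMap.ker p := LinearMap.codRestrict _ (LinearMap.id - b ∘ₗ a) fun x => by
    simp [hb', ha']
  obtain ⟨w, hw⟩ := hex (ModuleCat.ofHom (φ ∘ₗ bd)) (by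
    refine ModuleCat.hom_ext (LinearMap.ext fun x => ?_)
    have h0 : bd ((Q.complex.d 2 1).hom x) = 0 := by
      apply Subtype.ext
      change b ((Q.complex.d 1 0).hom ((Q.complex.d 2 1).hom x)) = 0
      have h1 : (Q.complex.d 1 0).hom ((Q.complex.d 2 1).hom x) = 0 :=
        congrArg (fun f => f.hom x) (Q.complex.d_comp_d 2 1 0)
      rw [h1, map_zero]
    change φ (bd ((Q.complex.d 2 1).hom x)) = 0
    rw [h0, map_zero])
  have hw' : ∀ y, w.hom ((Q.complex.d 1 0).hom y) = φ (bd y) := fun y =>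
    congrArg (fun f => f.hom y) hw
  refine ⟨w.hom ∘ₗ a + φ ∘ₗ c, fun k => ?_⟩
  obtain ⟨y, hy⟩ := hπd (a k) (by rw [ha']; exact k.2)
  rw [LinearMap.add_apply, LinearMap.comp_apply, LinearMap.comp_apply, ← hy, hw', ← map_add]
  congr 1
  apply Subtype.ext
  change b ((Q.complex.d 1 0).hom y) + ((k : F) - b (a k)) = k
  rw [hy]
  abel

/-- If `Ext^1(S, V) = 0`, computed by an injective resolution `J` of `V`, then maps from `S` lift
along the cokernel of any injection `V → G` with `G` injective. -/
theorem exists_lift_of_isZero_homology {V : ModuleCat.{u} R} (J : InjectiveResolution V)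
    (S : ModuleCat.{u} R) (hJ : Limits.IsZero
      ((((homFunctor S).mapHomologicalComplex (ComplexShape.up ℕ)).obj J.cocomplex).homology 1))
    {G L : Type u} [AddCommGroup G] [Module R G] [Module.Injective R G] [AddCommGroup L]
    [Module R L] (α : V →ₗ[R] G) (hα : Function.Injective α) (p : G →ₗ[R] L)
    (hp : Function.Surjective p) (hαp : Function.Exact α p) (h : S →ₗ[R] L) :
    ∃ g : S →ₗ[R] G, p ∘ₗ g = h := by
  have hex : ∀ z : S ⟶ J.cocomplex.X 1, z ≫ J.cocomplex.d 1 2 = 0 →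
      ∃ w : S ⟶ J.cocomplex.X 0, w ≫ J.cocomplex.d 0 1 = z := by
    have h := (HomologicalComplex.exactAt_iff_isZero_homology _ _).2 hJ
    rw [HomologicalComplex.exactAt_iff' _ 0 1 2 (by simp) (by simp),
      ShortComplex.moduleCat_exact_iff] at h
    exact h
  let ι : V →ₗ[R] J.cocomplex.X 0 := (J.ι.f 0).hom
  have hι : Function.Injective ι := (ModuleCat.mono_iff_injective (J.ι.f 0)).1 inferInstance
  have hιd : ∀ x, (J.cocomplex.d 0 1).hom x = 0 → ∃ v, ι v = x :=
    (ShortComplex.moduleCat_exact_iff _).1 J.exact₀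
  have hdι : ∀ v, (J.cocomplex.d 0 1).hom (ι v) = 0 := fun v =>
    congrArg (fun f => f.hom v) J.ι_f_zero_comp_complex_d
  have hJ0 : Module.Injective R (J.cocomplex.X 0) :=
    (Module.injective_iff_injective_object R (J.cocomplex.X 0)).2 (J.injective 0)
  -- Comparison maps under `V` in both directions. Both d ∘ a and 1 - ba vanish on `V`, so they
  -- descend to maps `da` and `c` on `L`; if d ∘ w = da ∘ h, then b ∘ w + c ∘ h lifts `h`.
  obtain ⟨a, ha⟩ := Module.Injective.out α hα ι
  obtain ⟨b, hb⟩ := Module.Injective.out ι hι α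
  have hfac : ∀ {X : Type u} [AddCommGroup X] [Module R X] (f : G →ₗ[R] X),
      (∀ v, f (α v) = 0) → ∃ f' : L →ₗ[R] X, ∀ x, f' (p x) = f x := by
    intro X _ _ f hf
    obtain ⟨f', hf'⟩ := LinearMap.exists_comp_eq_of_ker_le hp (f := f) fun x hx => by
      obtain ⟨v, rfl⟩ := (hαp x).1 hx
      exact hf v
    exact ⟨f', LinearMap.congr_fun hf'⟩
  obtain ⟨da, hda⟩ := hfac ((J.cocomplex.d 0 1).hom ∘ₗ a) fun v => by
    rw [LinearMap.comp_apply, ha, hdι]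
  obtain ⟨c, hc⟩ := hfac (LinearMap.id - b ∘ₗ a) fun v => by simp [ha, hb]
  obtain ⟨w, hw⟩ := hex (ModuleCat.ofHom (da ∘ₗ h)) (by
    refine ModuleCat.hom_ext (LinearMap.ext fun s => ?_)
    obtain ⟨g, hg⟩ := hp (h s)
    change (J.cocomplex.d 1 2).hom (da (h s)) = 0
    rw [← hg, hda]
    exact congrArg (fun f => f.hom (a g)) (J.cocomplex.d_comp_d 0 1 2))
  have hw' : ∀ s, (J.cocomplex.d 0 1).hom (w.hom s) = da (h s) := fun s =>
    congrArg (fun f => f.hom s) hw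
  refine ⟨b ∘ₗ w.hom + c ∘ₗ h, LinearMap.ext fun s => ?_⟩
  obtain ⟨g, hg⟩ := hp (h s)
  obtain ⟨v, hv⟩ := hιd (w.hom s - a g) (by
    rw [map_sub, hw', ← hg, hda, LinearMap.comp_apply, sub_self])
  have h1 : b (w.hom s) = b (a g) + α v := by
    rw [← hb, hv, map_sub]; abel
  rw [LinearMap.comp_apply, LinearMap.add_apply, LinearMap.comp_apply, LinearMap.comp_apply,
    ← hg, hc, h1, map_add, map_add, hαp.apply_apply_eq_zero, LinearMap.sub_apply, map_sub]
  simp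

/-- `C` is itself C-projective, so Hom(C, C) is projective and its higher Ext vanishes. -/
theorem isZero_relExtP_self {C : ModuleCat.{u} R} (hC : IsSemidualizing C) (N : ModuleCat.{u} R)
    (n : ℕ) : Limits.IsZero (relExtP C C N (n + 1)) := by
  have hself : IsCProjective C C :=
    ⟨ModuleCat.of R R, inferInstanceAs (Module.Projective R R), ⟨(TensorProduct.rid R C).symm⟩⟩
  have := hself.projective_hom hC
  let X := (ProperPResolution.nonempty C C).some
  exact (isZero_Ext_succ_of_projective _ _ n).of_iso
    (X.homologyIso hC (X.homResolution hC) N (n + 1) ≪≫ ((X.homResolution hC).isoExt _ _).symm)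

/-- C ⊗ N is injective, so it is its own injective resolution, concentrated in degree 0. -/
theorem isZero_relExtI_of_isCInjective [IsNoetherianRing R] {C : ModuleCat.{u} R}
    (hC : IsSemidualizing C) (M : ModuleCat.{u} R) {N : ModuleCat.{u} R} (hN : IsCInjective C N)
    (n : ℕ) : Limits.IsZero (relExtI C M N (n + 1)) := by
  have := hN.injective_tensor hC
  let Y := (ProperIResolution.nonempty C N).some
  let J := InjectiveResolution.self ((tensorFunctor C).obj N)
  refine Limits.IsZero.of_iso ?_ (Y.homologyIso hC J M (n + 1))
  rw [← HomologicalComplex.exactAt_iff_isZero_homology, HomologicalComplex.exactAt_iff]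
  refine ShortComplex.exact_of_isZero_X₂ _ ?_
  exact (homFunctor _).map_isZero (HomologicalComplex.isZero_single_obj_X _ _ _ _ (by simp))

/-- The vanishing for `C` transfers to Ext^1(Hom(B, C), Hom(B, R/m)) = 0, which contains the
obstruction to extending maps K → R/m to the free cover. -/
theorem projective_hom_of_forall_relExtP_equiv [IsNoetherianRing R] {B C : ModuleCat.{u} R}
    (hB : IsSemidualizing B) (hC : IsSemidualizing C)
    (h : ∀ N : ModuleCat.{u} R, Nonempty (relExtP C C N 1 ≃ₗ[R] relExtP B C N 1)) :
    Module.Projective R (B →ₗ[R] C) := by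
  have := hB.finite
  have := hC.finite
  let T := (homFunctor B).obj C
  let e : T ≃ₗ[R] (B →ₗ[R] C) := ModuleCat.homLinearEquiv (S := R)
  have : Module.Finite R T := Module.Finite.equiv e.symm
  suffices Module.Projective R T from Module.Projective.of_equiv e
  obtain ⟨n, p, hp⟩ := Module.Finite.exists_fin' R T
  refine Module.projective_of_lTensor_quotient_injective (LinearMap.ker p).subtype p hp
    (LinearMap.exact_subtype_ker_map p) fun m _ => ?_
  obtain ⟨f, b, hfb⟩ := hB.exists_apply_eq_one m
  refine lTensor_quotient_injective_of_extends m _ fun φ => ?_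
  let N : ModuleCat.{u} R := ModuleCat.of R (R ⧸ m)
  let X := (ProperPResolution.nonempty B C).some
  have h0 : Limits.IsZero (relExtP B C N 1) :=
    (isZero_relExtP_self hC N 0).of_iso (h N).some.toModuleIso.symm
  let e' : (homFunctor B).obj N ≃ₗ[R] (B →ₗ[R] (R ⧸ m)) := ModuleCat.homLinearEquiv (S := R)
  -- The map extended is k ↦ φ(k) f, with values in Hom(B, R/m). Evaluating the extension at `b`
  -- recovers `φ` because f(b) = 1.
  obtain ⟨ψ, hψ⟩ := exists_extension_of_isZero_homology (X.homResolution hB) _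
    (h0.of_iso (X.homologyIso hB (X.homResolution hB) N 1).symm) p hp
    (e'.symm.toLinearMap ∘ₗ f.lcomp R (R ⧸ m) ∘ₗ LinearMap.mul R (R ⧸ m) ∘ₗ φ)
  let ψ' : (Fin n → R) →ₗ[R] (R ⧸ m) := LinearMap.applyₗ b ∘ₗ e'.toLinearMap ∘ₗ ψ
  refine ⟨N, LinearMap.id, ψ'.lcomp R (R ⧸ m) ∘ₗ LinearMap.mul R (R ⧸ m),
    Function.injective_id, fun k => ?_⟩
  have h1 : ψ' k = φ k := by
    change e' (ψ k) b = _
    rw [hψ]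
    simp [hfb]
  change 1 * ψ' k = φ k
  rw [h1, one_mul]

/-- With T = Hom(B, C) and N = Hom(C, E), the module B ⊗ N is Hom(T, E). Dualizing 0 → K → F → T → 0
into `E` embeds it in the injective module Hom(F, E) with cokernel Hom(K, E), along which maps from
B ⊗ R/m lift. -/
theorem projective_hom_of_forall_relExtI_equiv [IsNoetherianRing R] {B C : ModuleCat.{u} R}
    (hB : IsSemidualizing B) (hC : IsSemidualizing C)
    (h : ∀ M N : ModuleCat.{u} R, Nonempty (relExtI C M N 1 ≃ₗ[R] relExtI B M N 1)) :
    Module.Projective R (B →ₗ[R] C) := by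
  have := hB.finite
  have := hC.finite
  obtain ⟨n, p, hp⟩ := Module.Finite.exists_fin' R (B →ₗ[R] C)
  refine Module.projective_of_lTensor_quotient_injective (LinearMap.ker p).subtype p hp
    (LinearMap.exact_subtype_ker_map p) fun m _ => ?_
  obtain ⟨f, b, hfb⟩ := hB.exists_apply_eq_one m
  refine lTensor_quotient_injective_of_extends m _ fun φ => ?_
  let E : ModuleCat.{u} R := Injective.under (ModuleCat.of R (R ⧸ m))
  let j : (R ⧸ m) →ₗ[R] E := (Injective.ι (ModuleCat.of R (R ⧸ m))).hom
  have hj : Function.Injective j := (ModuleCat.mono_iff_injective _).1 inferInstance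
  have hE : Module.Injective R E := (Module.injective_iff_injective_object R _).2
    (inferInstanceAs (Injective (Injective.under _)))
  let M : ModuleCat.{u} R := ModuleCat.of R (R ⧸ m)
  let N : ModuleCat.{u} R := ModuleCat.of R (C →ₗ[R] E)
  let Y := (ProperIResolution.nonempty B N).some
  have h0 : Limits.IsZero (relExtI B M N 1) :=
    (isZero_relExtI_of_isCInjective hC M ⟨E, hE, ⟨LinearEquiv.refl R _⟩⟩ 0).of_iso
      (h M N).some.toModuleIso.symm
  have hJ := h0.of_iso (Y.homologyIso hB (Y.tensorResolution hB) M 1).symm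
  have hG : Module.Injective R ((Fin n → R) →ₗ[R] E) := Module.Injective.linearMap_of_flat
  let α : (B ⊗[R] (C →ₗ[R] E)) →ₗ[R] ((Fin n → R) →ₗ[R] E) :=
    p.lcomp R E ∘ₗ tensorHomEval R B C E
  have hα : Function.Injective α := by
    refine Function.Injective.comp (g := p.lcomp R E) (fun x y hxy => ?_)
      tensorHomEval_bijective.1
    ext t
    obtain ⟨v, rfl⟩ := hp t
    exact LinearMap.congr_fun hxy v
  have hres : Function.Surjective ((LinearMap.ker p).subtype.lcomp R E) := fun g => by
    obtain ⟨g', hg'⟩ := Module.Injective.out (LinearMap.ker p).subtype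
      (LinearMap.ker p).injective_subtype g
    exact ⟨g', LinearMap.ext hg'⟩
  have hex : Function.Exact α ((LinearMap.ker p).subtype.lcomp R E) := by
    intro g
    constructor
    · intro hg
      obtain ⟨g', hg'⟩ := LinearMap.exists_comp_eq_of_ker_le hp (f := g) fun x hx =>
        LinearMap.congr_fun hg ⟨x, hx⟩
      obtain ⟨y, hy⟩ := tensorHomEval_bijective.2 g'
      exact ⟨y, (congrArg (p.lcomp R E) hy).trans hg'⟩
    · rintro ⟨y, rfl⟩
      ext k
      change tensorHomEval R B C E y (p k) = 0
      rw [LinearMap.mem_ker.1 k.2, map_zero]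
  -- Here t(c) is k ↦ j(c φ(k)) and s(b' ⊗ c) = t(f(b') c), so s(b ⊗ 1) = j ∘ φ. A lift of `s`
  -- evaluated at b ⊗ 1 extends j ∘ φ to the free module.
  let t : (R ⧸ m) →ₗ[R] (LinearMap.ker p →ₗ[R] E) :=
    j.compRight R ∘ₗ φ.lcomp R (R ⧸ m) ∘ₗ LinearMap.mul R (R ⧸ m)
  let s : (B ⊗[R] (R ⧸ m)) →ₗ[R] (LinearMap.ker p →ₗ[R] E) :=
    t ∘ₗ TensorProduct.lift (LinearMap.mul R (R ⧸ m) ∘ₗ f)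
  obtain ⟨g, hg⟩ := exists_lift_of_isZero_homology (Y.tensorResolution hB) _ hJ α hα _ hres hex s
  refine ⟨E, j, g ∘ₗ TensorProduct.mk R B (R ⧸ m) b, hj, fun k => ?_⟩
  have h1 := LinearMap.congr_fun (LinearMap.congr_fun hg (b ⊗ₜ (1 : R ⧸ m))) k
  have h2 : s (b ⊗ₜ (1 : R ⧸ m)) k = j (φ k) := by simp [s, t, hfb]
  exact h1.trans h2

end Converse

end

theorem theorem3p3 {R : Type u} [CommRing R] [IsNoetherianRing R] [Nontrivial R]
    (B C : ModuleCat.{u} R) (hB : IsSemidualizing B) (hC : IsSemidualizing C) :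
    List.TFAE [
      PicEquivalent B C,
      ∀ (M N : ModuleCat.{u} R) (i : ℕ), Nonempty (relExtP C M N i ≃ₗ[R] relExtP B M N i),
      ∀ (M N : ModuleCat.{u} R) (i : ℕ), Nonempty (relExtI C M N i ≃ₗ[R] relExtI B M N i)] := by
  tfae_have 1 → 2 := fun h M N i => relExtP_equiv_of_picEquivalent hB h M N i
  tfae_have 1 → 3 := fun h M N i => relExtI_equiv_of_picEquivalent hB h M N i
  -- M = C makes the C-side vanish and M = B the B-side; the two cases give projectivity of Hom(B,
  -- C) and of Hom(C, B).
  tfae_have 2 → 1 := fun h => PicEquivalent.of_projective_hom hB hC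
    (projective_hom_of_forall_relExtP_equiv hB hC fun N => h C N 1)
    (projective_hom_of_forall_relExtP_equiv hC hB fun N => ⟨(h B N 1).some.symm⟩)
  tfae_have 3 → 1 := fun h => PicEquivalent.of_projective_hom hB hC
    (projective_hom_of_forall_relExtI_equiv hB hC fun M N => h M N 1)
    (projective_hom_of_forall_relExtI_equiv hC hB fun M N => ⟨(h M N 1).some.symm⟩)
  tfae_finish
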